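/- Let $G$ be a finite, simple, connected, cubic planar graph, embedded in the sphere, and let $G^\ast$ be the dual graph of this embedding (its vertices are the faces; two distinct faces are adjacent if they share an edge). Suppose that $G$ is cyclically $5$-edge-connected, i.e. there is no set $A$ of at most four edges such that $G\setminus A$ has at least two connected components containing a cycle. Let $v\neq w$ be two adjacent vertices of $G^\ast$, i.e. two faces of $G$ sharing an edge, of lengths $2k+1$ and $2m+1$ respectively, where $k,m\ge 2$. Then $G$ has a strong embedding (a cellular embedding all of whose facial walks are cycles) on the orientable surface of genus $k+m-2$. More precisely, $G^\ast$ contains a cycle $C$ of even length $2(k+m-1)$ whose vertices are exactly the vertices of $G^\ast$ that are different from $v$ and $w$ and adjacent to $v$ or to $w$. Keep the rotation system $\rho$ of the embedding of $G$ in the sphere (the cyclic orders of the edges at the vertices, with no twisted edges) and twist exactly those edges of $G$ whose dual edge lies in $C$, i.e. give these edges signature $-1$ and all other edges signature $+1$. Then the embedding of $G$ defined by $\rho$ and this signature is strong, and its surface is orientable of genus $k+m-2$. -/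

import Mathlib

namespace SimpleGraph

universe u

/-- `G` is cyclically `k`-edge-connected: there is no set `A` of fewer than `k` edges such that
`G \ A` has two different connected components each of which contains a cycle. -/
def CyclicallyEdgeConnected {V : Type u} (G : SimpleGraph V) (k : ℕ) : Prop :=
  ∀ A : Finset (Sym2 V), (A : Set (Sym2 V)) ⊆ G.edgeSet → A.card < k →
    ¬ ∃ (x y : V) (p : (G.deleteEdges (A : Set (Sym2 V))).Walk x x)
        (q : (G.deleteEdges (A : Set (Sym2 V))).Walk y y),
      p.IsCycle ∧ q.IsCycle ∧
      (G.deleteEdges (A : Set (Sym2 V))).connectedComponentMk x ≠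
        (G.deleteEdges (A : Set (Sym2 V))).connectedComponentMk y

/-- A rotation system of `G`: for each vertex, a cyclic ordering of the edges incident to it.
The edges at a vertex `x` are represented by the darts (oriented edges) with first vertex `x`;
`next` maps each dart to its successor in the cyclic ordering at its first vertex. -/
structure RotationSystem {V : Type u} (G : SimpleGraph V) where
  next : Equiv.Perm G.Dart
  fst_next : ∀ d, (next d).fst = d.fst
  sameCycle : ∀ d d' : G.Dart, d.fst = d'.fst → next.SameCycle d d'

/-- A (combinatorial) cellular embedding of a graph on a closed surface: a rotation system
together with a signature. The edges of signature `-1` are the twisted edges. -/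
structure SurfaceEmbedding {V : Type u} (G : SimpleGraph V) where
  rot : G.RotationSystem
  sign : Sym2 V → ℤˣ

namespace SurfaceEmbedding

variable {V : Type u} {G : SimpleGraph V} (E : G.SurfaceEmbedding)

/-- One step of the face traversal algorithm. A state `(d, s)` consists of the dart `d` that is
about to be traversed and the current orientation `s` (`1`: the rotation is used as it is,
`-1`: it is reversed). Traversing a twisted edge changes the orientation; at the end of the edge
the walk continues along the next dart with respect to the current orientation. -/
def step (x : G.Dart × ℤˣ) : G.Dart × ℤˣ :=
  ((E.rot.next ^ ((x.2 * E.sign x.1.edge : ℤˣ) : ℤ)) x.1.symm, x.2 * E.sign x.1.edge)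

/-- The state that traverses the same side of the same edge in the opposite direction. -/
def rev (x : G.Dart × ℤˣ) : G.Dart × ℤˣ :=
  (x.1.symm, -(x.2 * E.sign x.1.edge))

/-- The cells (faces) of the embedding. They correspond to the facial walks, i.e. to the orbits of
the face traversal, where a walk is identified with its reversal. -/
def Face : Type u :=
  Quot fun x y : G.Dart × ℤˣ => y = E.step x ∨ y = E.rev x

/-- The face whose facial walk runs through the state `x`. -/
def faceOf (x : G.Dart × ℤˣ) : E.Face := Quot.mk _ x

theorem rev_rev (x : G.Dart × ℤˣ) : E.rev (E.rev x) = x := by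
  obtain ⟨d, s⟩ := x
  simp [rev, mul_assoc]

theorem step_rev_step (x : G.Dart × ℤˣ) : E.step (E.rev (E.step x)) = E.rev x := by
  obtain ⟨d, s⟩ := x
  simp [rev, step, mul_assoc]

theorem step_injective : Function.Injective E.step := by
  intro x y h
  have h' : E.rev x = E.rev y := by rw [← E.step_rev_step x, ← E.step_rev_step y, h]
  rw [← E.rev_rev x, ← E.rev_rev y, h']

theorem isPeriodicPt_rev {n : ℕ} {x : G.Dart × ℤˣ} (h : Function.IsPeriodicPt E.step n x) :
    Function.IsPeriodicPt E.step n (E.rev x) := by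
  have key : ∀ (n : ℕ) (y : G.Dart × ℤˣ), E.step^[n] (E.rev (E.step^[n] y)) = E.rev y := by
    intro n
    induction n with
    | zero => intro y; rfl
    | succ n ih =>
      intro y
      rw [Function.iterate_succ_apply', Function.iterate_succ_apply, ih, E.step_rev_step]
  have := key n x
  rw [h.eq] at this
  exact this

/-- The length of (the facial walk of) a face. -/
noncomputable def Face.length {E : G.SurfaceEmbedding} (f : E.Face) : ℕ :=
  Quot.lift (fun x => Function.minimalPeriod E.step x) (by
    rintro x y (rfl | rfl)
    · refine Function.minimalPeriod_eq_minimalPeriod_iff.2 fun n => ?_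
      refine ⟨fun h => h.apply_iterate 1, fun h => E.step_injective ?_⟩
      rw [← Function.iterate_succ_apply' E.step n x, Function.iterate_succ_apply]
      exact h
    · refine Function.minimalPeriod_eq_minimalPeriod_iff.2 fun n => ?_
      refine ⟨E.isPeriodicPt_rev, fun h => ?_⟩
      rw [← E.rev_rev x]
      exact E.isPeriodicPt_rev h) f

/-- The embedding is strong: every facial walk is a cycle, i.e. it has length at least three and
the vertices that it visits before returning to its start are pairwise distinct. -/
def IsStrong : Prop :=
  ∀ x : G.Dart × ℤˣ, 3 ≤ Function.minimalPeriod E.step x ∧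
    ∀ i < Function.minimalPeriod E.step x, ∀ j < Function.minimalPeriod E.step x,
      (E.step^[i] x).1.fst = (E.step^[j] x).1.fst → i = j

/-- The surface is orientable: every cycle of the graph has an even number of twisted edges. -/
def IsOrientable : Prop :=
  ∀ (x : V) (p : G.Walk x x), p.IsCycle → (p.edges.map E.sign).prod = 1

/-- The Euler characteristic of the surface (of a connected finite graph with an edge). -/
noncomputable def eulerChar : ℤ :=
  (Nat.card V : ℤ) - (Nat.card G.edgeSet : ℤ) + (Nat.card E.Face : ℤ)

/-- The surface is the orientable surface of genus `g`. -/
def OnOrientableSurface (g : ℕ) : Prop :=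
  E.IsOrientable ∧ E.eulerChar = 2 - 2 * (g : ℤ)

/-- The dual of the edge `e` joins the faces `f` and `f'`, which are the faces on the two sides
of `e`. -/
def DualJoins (e : Sym2 V) (f f' : E.Face) : Prop :=
  ∃ (d : G.Dart) (s : ℤˣ), d.edge = e ∧ f = E.faceOf (d, s) ∧ f' = E.faceOf (d, -s)

/-- The dual graph: its vertices are the faces, and two different faces are adjacent if there is
an edge of `G` with these faces on its two sides. -/
def dualGraph : SimpleGraph E.Face where
  Adj f f' := f ≠ f' ∧ ∃ e, E.DualJoins e f f'
  symm := ⟨by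
    rintro f f' ⟨hne, e, d, s, he, hf, hf'⟩
    exact ⟨hne.symm, e, d, -s, he, hf', by rw [neg_neg]; exact hf⟩⟩
  loopless := ⟨fun _ h => h.1 rfl⟩

end SurfaceEmbedding

namespace RotationSystem

variable {V : Type u} {G : SimpleGraph V} (ρ : G.RotationSystem)

/-- The embedding given by a rotation system without twisted edges. -/
def untwisted : G.SurfaceEmbedding := ⟨ρ, fun _ => 1⟩

/-- The rotation system (without twisted edges) describes an embedding on the sphere. -/
def IsPlanar : Prop := ρ.untwisted.OnOrientableSurface 0

open Classical in
/-- The embedding defined by a twisted subgraph `H` of the dual graph: the rotation system is kept,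
and an edge is twisted if and only if its dual edge is contained in `H`. -/
noncomputable def twist (H : ρ.untwisted.dualGraph.Subgraph) : G.SurfaceEmbedding :=
  ⟨ρ, fun e => if ∃ f f', H.Adj f f' ∧ ρ.untwisted.DualJoins e f f' then -1 else 1⟩

end RotationSystem

end SimpleGraph

/-! Call a vertex of `G` near if it lies on `v` or `w`. The faces around `v` and `w` close up to a
ring, and the edges between two ring faces are exactly the edges with one near end
(`not_nearVertex_iff` and the fields of `IsRing`). So the twisted edges form a cut, and reversing
the rotation at all near vertices would remove every twist: the new surface is orientable.

A new facial walk follows an old face up to a twisted edge and there changes to the old face on the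
other side. Faces outside the ring have no twisted edge and survive. Inside the ring the walk passes
to a neighbouring ring face and changes between the near and the far part of the boundary, so the
parity of the ring position plus the indicator of nearness is constant (`ringLabel_step`). Since the
number `n` of ring faces is even, these are replaced by exactly two new faces (`natCard_face`), and
Euler's formula gives `n = 2 * g + 2`. The new facial walks are cycles: at a repeated vertex the
orientation is the same, and two different ring faces at one vertex are separated by a twisted edge,
hence have different parities, so the label determines the state (`eq_of_ringLabel_eq`).

Connectivity enters through `exists_finset_of_closed`. By Euler's formula over `𝔽₂`, the edges
crossed by a closed dual walk form a cut (`IsPlanar.exists_cut`). If there are `r ≤ 4` of them, one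
side induces a forest, and counting degrees leaves it at most `r - 2` vertices. So the dual has no
loops or multiple edges, the edges of a dual triangle share a vertex, and those of a dual quadrangle
are covered by two vertices. This makes the ring free of repetitions (`exists_isRing`) and yields
`not_nearVertex_iff`. -/

theorem Equiv.Perm.SameCycle.map_eq {α β : Type*} {σ : Equiv.Perm α} {x y : α}
    (h : σ.SameCycle x y) {g : α → β} (hg : ∀ z, g (σ z) = g z) : g x = g y := by
  have hinv : ∀ z, g (σ⁻¹ z) = g z := fun z => by
    rw [← hg (σ⁻¹ z)]; simp
  obtain ⟨n, rfl⟩ := h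
  induction n with
  | zero => rfl
  | succ n ih => rw [ih, add_comm, zpow_add, zpow_one, Equiv.Perm.mul_apply, hg]
  | pred n ih =>
    rw [ih, sub_eq_add_neg, add_comm, zpow_add, zpow_neg_one, Equiv.Perm.mul_apply, hinv]

/-! ### Faces of the untwisted embedding as cycles of a permutation of the darts -/

namespace SimpleGraph

namespace RotationSystem

variable {V : Type*} {G : SimpleGraph V} (ρ : G.RotationSystem)

/-- The facial permutation of a rotation system: the dart that follows `d` on the face to which
`d` belongs. -/
def faceNext : Equiv.Perm G.Dart := (Dart.symm_involutive (G := G)).toPerm.trans ρ.next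

theorem faceNext_apply (d : G.Dart) : ρ.faceNext d = ρ.next d.symm := rfl

@[simp] theorem fst_faceNext (d : G.Dart) : (ρ.faceNext d).fst = d.snd := ρ.fst_next _

@[simp] theorem next_faceNext_symm (d : G.Dart) : ρ.faceNext d.symm = ρ.next d := by
  simp [faceNext_apply]

/-- The face of the untwisted embedding whose facial walk runs through the dart `d`. -/
def dartFace (d : G.Dart) : ρ.untwisted.Face := ρ.untwisted.faceOf (d, 1)

theorem untwisted_step_one (d : G.Dart) : ρ.untwisted.step (d, 1) = (ρ.faceNext d, 1) := by
  simp [SurfaceEmbedding.step, untwisted, faceNext_apply]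

theorem untwisted_rev (d : G.Dart) (s : ℤˣ) : ρ.untwisted.rev (d, s) = (d.symm, -s) := by
  simp [SurfaceEmbedding.rev, untwisted]

theorem iterate_untwisted_step (n : ℕ) (d : G.Dart) :
    ρ.untwisted.step^[n] (d, 1) = ((ρ.faceNext ^ n) d, 1) := by
  induction n with
  | zero => rfl
  | succ n ih =>
    rw [Function.iterate_succ_apply', ih, untwisted_step_one, pow_succ', Equiv.Perm.mul_apply]

theorem faceOf_untwisted_neg (d : G.Dart) (s : ℤˣ) :
    ρ.untwisted.faceOf (d, -s) = ρ.untwisted.faceOf (d.symm, s) := by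
  refine Quot.sound (Or.inr ?_)
  rw [untwisted_rev, neg_neg]

theorem faceOf_untwisted_one (d : G.Dart) : ρ.untwisted.faceOf (d, 1) = ρ.dartFace d := rfl

theorem faceOf_untwisted_neg_one (d : G.Dart) :
    ρ.untwisted.faceOf (d, -1) = ρ.dartFace d.symm := ρ.faceOf_untwisted_neg d 1

@[simp] theorem dartFace_faceNext (d : G.Dart) : ρ.dartFace (ρ.faceNext d) = ρ.dartFace d := by
  refine Eq.symm (Quot.sound (Or.inl ?_))
  rw [untwisted_step_one]

@[simp] theorem dartFace_faceNext_pow (n : ℕ) (d : G.Dart) :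
    ρ.dartFace ((ρ.faceNext ^ n) d) = ρ.dartFace d := by
  induction n with
  | zero => rfl
  | succ n ih => rw [pow_succ', Equiv.Perm.mul_apply, dartFace_faceNext, ih]

theorem dartFace_next (d : G.Dart) : ρ.dartFace (ρ.next d) = ρ.dartFace d.symm := by
  rw [← next_faceNext_symm, dartFace_faceNext]

theorem dartFace_surjective : Function.Surjective ρ.dartFace := by
  rintro ⟨d, s⟩
  rcases Int.units_eq_one_or s with rfl | rfl
  · exact ⟨d, rfl⟩
  · exact ⟨d.symm, (ρ.faceOf_untwisted_neg_one d).symm⟩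

/-- Without twists, `(d, -1)` runs along the same side as `(d.symm, 1)`. Sending these states to the
cycle of `d.symm` is compatible with both relations that define faces. -/
theorem dartFace_eq_iff {d d' : G.Dart} :
    ρ.dartFace d = ρ.dartFace d' ↔ ρ.faceNext.SameCycle d d' := by
  constructor
  · let S := Equiv.Perm.SameCycle.setoid ρ.faceNext
    let F : ρ.untwisted.Face → Quotient S :=
      Quot.lift (fun x => if x.2 = 1 then Quotient.mk S x.1 else Quotient.mk S x.1.symm) (by
        rintro ⟨d, s⟩ y (rfl | rfl)
        · rcases Int.units_eq_one_or s with rfl | rfl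
          · rw [untwisted_step_one]
            simpa [S] using Quotient.sound (s := S) (Equiv.Perm.SameCycle.refl ρ.faceNext d).apply_right
          · have h : ρ.faceNext (ρ.next⁻¹ d.symm).symm = d.symm := by simp [faceNext_apply]
            have : Quotient.mk S (ρ.next⁻¹ d.symm).symm = Quotient.mk S d.symm :=
              Quotient.sound (s := S) (by
                have := (Equiv.Perm.SameCycle.refl ρ.faceNext (ρ.next⁻¹ d.symm).symm).apply_right
                rwa [h] at this)
            have hne : (-1 : ℤˣ) ≠ 1 := by decide
            simpa [SurfaceEmbedding.step, untwisted, hne] using this.symm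
        · rw [untwisted_rev]
          have hne : (-1 : ℤˣ) ≠ 1 := by decide
          rcases Int.units_eq_one_or s with rfl | rfl <;> simp [hne])
    intro h
    have := congrArg F h
    exact Quotient.exact (s := S) (by simpa [F, dartFace, SurfaceEmbedding.faceOf] using this)
  · exact fun h => h.map_eq ρ.dartFace_faceNext

theorem dualJoins_untwisted {e : Sym2 V} {f f' : ρ.untwisted.Face} :
    ρ.untwisted.DualJoins e f f' ↔
      ∃ d : G.Dart, d.edge = e ∧ ρ.dartFace d = f ∧ ρ.dartFace d.symm = f' := by
  constructor
  · rintro ⟨d, s, he, hf, hf'⟩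
    rcases Int.units_eq_one_or s with rfl | rfl
    · exact ⟨d, he, hf.symm, by rw [hf', faceOf_untwisted_neg_one]⟩
    · refine ⟨d.symm, by simpa using he, by rw [hf, faceOf_untwisted_neg_one], ?_⟩
      rw [hf', neg_neg, Dart.symm_symm]; rfl
  · rintro ⟨d, he, hf, hf'⟩
    exact ⟨d, 1, he, hf.symm, by rw [← hf', faceOf_untwisted_neg_one]⟩

theorem dualGraph_adj {f f' : ρ.untwisted.Face} :
    ρ.untwisted.dualGraph.Adj f f' ↔
      f ≠ f' ∧ ∃ d : G.Dart, ρ.dartFace d = f ∧ ρ.dartFace d.symm = f' := by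
  change (f ≠ f' ∧ ∃ e, _) ↔ _
  simp only [dualJoins_untwisted]
  constructor
  · rintro ⟨h, e, d, -, h1⟩; exact ⟨h, d, h1⟩
  · rintro ⟨h, d, h1⟩; exact ⟨h, _, d, rfl, h1⟩

theorem length_dartFace (d : G.Dart) :
    (ρ.dartFace d).length = Function.minimalPeriod ρ.faceNext d := by
  change Function.minimalPeriod ρ.untwisted.step (d, 1) = _
  refine Function.minimalPeriod_eq_minimalPeriod_iff.2 fun n => ?_
  rw [Function.IsPeriodicPt, Function.IsFixedPt, iterate_untwisted_step, Function.IsPeriodicPt,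
    Function.IsFixedPt, ← Equiv.Perm.coe_pow]
  simp

end RotationSystem

/-! ### Planar duality over `𝔽₂` -/

section Planarity

open Finset Matrix

variable {V : Type*} {G : SimpleGraph V}

open Classical in
/-- The incidence matrix over `𝔽₂` of the graph that is obtained from `G` by sending the initial
end of each dart `d` to `π d`. -/
noncomputable def dartIncMatrix [Fintype G.Dart] {X : Type*} (π : G.Dart → X) :
    Matrix X G.edgeSet (ZMod 2) :=
  Matrix.of fun x e => ∑ d : G.Dart, if π d = x ∧ d.edge = e then 1 else 0

open Classical in
theorem dartIncMatrix_mulVec [Fintype G.Dart] [Fintype G.edgeSet] {X : Type*} (π : G.Dart → X)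
    (h : G.edgeSet → ZMod 2) (x : X) :
    (dartIncMatrix π *ᵥ h) x = ∑ d : G.Dart, if π d = x then h ⟨d.edge, d.edge_mem⟩ else 0 := by
  simp only [mulVec, dotProduct, dartIncMatrix, of_apply, sum_mul, ite_mul, one_mul, zero_mul]
  rw [sum_comm]
  refine sum_congr rfl fun d _ => ?_
  rw [sum_eq_single ⟨d.edge, d.edge_mem⟩]
  · simp
  · rintro e - he
    rw [if_neg]
    rintro ⟨-, h2⟩
    exact he (Subtype.ext h2.symm)
  · simp

open Classical in
theorem dartIncMatrix_transpose_mulVec [Fintype G.Dart] {X : Type*} [Fintype X] (π : G.Dart → X)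
    (g : X → ZMod 2) (d : G.Dart) :
    ((dartIncMatrix π)ᵀ *ᵥ g) ⟨d.edge, d.edge_mem⟩ = g (π d) + g (π d.symm) := by
  simp only [mulVec, dotProduct, dartIncMatrix, transpose_apply, of_apply, sum_mul, ite_mul,
    one_mul, zero_mul]
  rw [sum_comm]
  have : ∀ d' : G.Dart, (∑ x, if π d' = x ∧ d'.edge = d.edge then g x else 0) =
      if d'.edge = d.edge then g (π d') else 0 := by
    intro d'
    by_cases h : d'.edge = d.edge <;> simp [h]
  simp only [this]
  rw [← sum_filter]
  have : (univ.filter fun d' : G.Dart => d'.edge = d.edge) = {d, d.symm} := by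
    ext d'; simp [dart_edge_eq_iff]
  rw [this, sum_pair d.symm_ne.symm]

/-- The hypothesis says that the kernel of the transpose consists of the constant functions, a space
of dimension one. It is used for the vertices and for the faces. -/
theorem rank_dartIncMatrix [Fintype G.Dart] [Fintype G.edgeSet] {X : Type*} [Fintype X]
    [Nonempty X] (π : G.Dart → X)
    (hπ : ∀ g : X → ZMod 2, (∀ d : G.Dart, g (π d) = g (π d.symm)) → ∀ x y, g x = g y) :
    (dartIncMatrix π).rank + 1 = Fintype.card X := by
  rw [← rank_transpose]
  have h := LinearMap.finrank_range_add_finrank_ker (dartIncMatrix π)ᵀ.mulVecLin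
  rw [Module.finrank_fintype_fun_eq_card] at h
  rw [← h]
  congr 1
  symm
  rw [finrank_eq_one_iff']
  refine ⟨⟨fun _ => 1, ?_⟩, ?_, ?_⟩
  · rw [LinearMap.mem_ker]
    ext ⟨e, he⟩
    induction e with | _ a b =>
    have := dartIncMatrix_transpose_mulVec π (fun _ => 1) ⟨(a, b), he⟩
    rw [mulVecLin_apply]
    exact this.trans (CharTwo.add_self_eq_zero _)
  · intro h0
    have := congrFun (congrArg Subtype.val h0) (Classical.arbitrary X)
    exact one_ne_zero this
  · rintro ⟨g, hg⟩
    have hc : ∀ x y, g x = g y := by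
      refine hπ g fun d => ?_
      have := congrFun (LinearMap.mem_ker.1 hg) ⟨d.edge, d.edge_mem⟩
      rw [mulVecLin_apply, dartIncMatrix_transpose_mulVec] at this
      exact CharTwo.add_eq_zero.1 this
    refine ⟨g (Classical.arbitrary X), Subtype.ext (funext fun x => ?_)⟩
    simp [hc x (Classical.arbitrary X)]

theorem Connected.constant_of_dart (hconn : G.Connected) {α : Type*} (g : V → α)
    (h : ∀ d : G.Dart, g d.fst = g d.snd) (x y : V) : g x = g y := by
  obtain ⟨p⟩ := hconn.preconnected x y
  induction p with
  | nil => rfl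
  | cons hadj p ih => exact (h ⟨(_, _), hadj⟩).trans ih

namespace RotationSystem

variable (ρ : G.RotationSystem)

/-- This is connectedness of the dual graph: turning around a vertex crosses one edge after the
other, and a walk in `G` leads from vertex to vertex. -/
theorem constant_of_dartFace (hconn : G.Connected) {α : Type*} (g : ρ.untwisted.Face → α)
    (h : ∀ d : G.Dart, g (ρ.dartFace d) = g (ρ.dartFace d.symm)) (f f' : ρ.untwisted.Face) :
    g f = g f' := by
  have hfst : ∀ d d' : G.Dart, d.fst = d'.fst → g (ρ.dartFace d) = g (ρ.dartFace d') :=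
    fun d d' hd => (ρ.sameCycle d d' hd).map_eq (g := fun d => g (ρ.dartFace d)) fun d => by
      rw [dartFace_next, ← h]
  have key : ∀ (x y : V) (_ : G.Walk x y) (d d' : G.Dart), d.fst = x → d'.fst = y →
      g (ρ.dartFace d) = g (ρ.dartFace d') := by
    intro x y p
    induction p with
    | nil => exact fun d d' hd hd' => hfst d d' (hd.trans hd'.symm)
    | cons hadj p ih =>
      intro d d' hd hd'
      rw [hfst d ⟨(_, _), hadj⟩ hd, h]
      exact ih _ _ rfl hd'
  obtain ⟨d, rfl⟩ := ρ.dartFace_surjective f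
  obtain ⟨d', rfl⟩ := ρ.dartFace_surjective f'
  obtain ⟨p⟩ := hconn.preconnected d.fst d'.fst
  exact key _ _ p _ _ rfl rfl

theorem finite_face [Finite G.Dart] (E : G.SurfaceEmbedding) : Finite E.Face :=
  Finite.of_surjective E.faceOf Quot.mk_surjective

open Classical in
/-- In a planar embedding, a set of edges that meets each facial walk evenly is a cut. -/
theorem IsPlanar.exists_cut [Finite V] [Fintype G.Dart] {ρ : G.RotationSystem} (hρ : ρ.IsPlanar)
    (hconn : G.Connected) (h : Sym2 V → ZMod 2)
    (hh : ∀ f, (∑ d : G.Dart, if ρ.dartFace d = f then h d.edge else 0) = 0) :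
    ∃ g : V → ZMod 2, ∀ d : G.Dart, h d.edge = g d.fst + g d.snd := by
  cases nonempty_fintype V
  have := finite_face ρ.untwisted
  cases nonempty_fintype ρ.untwisted.Face
  cases nonempty_fintype G.edgeSet
  have hne : Nonempty V := hconn.nonempty
  by_cases hd : Nonempty G.Dart
  swap
  · exact ⟨0, fun d => (hd ⟨d⟩).elim⟩
  have hnef : Nonempty ρ.untwisted.Face := hd.map ρ.dartFace
  have rV := rank_dartIncMatrix (fun d : G.Dart => d.fst) fun g hg => hconn.constant_of_dart g hg
  have rF := rank_dartIncMatrix ρ.dartFace fun g hg => ρ.constant_of_dartFace hconn g hg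
  have hE := hρ.2
  simp only [SurfaceEmbedding.eulerChar, Nat.card_eq_fintype_card] at hE
  -- Along a facial walk the terminal vertices are the initial vertices shifted by one, so every cut
  -- meets it evenly.
  have hle : LinearMap.range (dartIncMatrix fun d : G.Dart => d.fst)ᵀ.mulVecLin ≤
      LinearMap.ker (dartIncMatrix ρ.dartFace).mulVecLin := by
    rintro _ ⟨g, rfl⟩
    rw [LinearMap.mem_ker]
    ext f
    simp only [mulVecLin_apply, dartIncMatrix_mulVec, dartIncMatrix_transpose_mulVec,
      Pi.zero_apply]
    rw [← sum_filter, sum_add_distrib, CharTwo.add_eq_zero]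
    refine (sum_equiv ρ.faceNext (fun d => by simp) fun d _ => ?_).symm
    simp
  -- Both dimensions are `|V| - 1`: the kernel has dimension `|E| - (|F| - 1)`, to which Euler's
  -- formula applies.
  have heq := Submodule.eq_of_le_of_finrank_eq hle (by
    have h1 := LinearMap.finrank_range_add_finrank_ker (dartIncMatrix ρ.dartFace).mulVecLin
    rw [Module.finrank_fintype_fun_eq_card] at h1
    rw [← rank_transpose] at rV
    unfold Matrix.rank at rV rF
    omega)
  have hmem : (fun e : G.edgeSet => h e) ∈ LinearMap.ker (dartIncMatrix ρ.dartFace).mulVecLin := by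
    rw [LinearMap.mem_ker]
    ext f
    rw [mulVecLin_apply, dartIncMatrix_mulVec]
    exact hh f
  rw [← heq] at hmem
  obtain ⟨g, hg⟩ := hmem
  refine ⟨g, fun d => ?_⟩
  exact (congrFun hg ⟨d.edge, d.edge_mem⟩).symm.trans
    (dartIncMatrix_transpose_mulVec (fun d : G.Dart => d.fst) g d)

end RotationSystem

end Planarity

end SimpleGraph

/-! ### Small edge cuts and short closed walks in the dual graph -/

namespace SimpleGraph

section Cuts

open Finset

variable {V : Type*} {G : SimpleGraph V}

theorem IsAcyclic.card_edgeFinset_lt [Fintype V] [Nonempty V] [Fintype G.edgeSet]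
    (h : G.IsAcyclic) : #G.edgeFinset < Fintype.card V := by
  classical
  obtain ⟨T, hGT, -, hT⟩ := (connected_top (V := V)).exists_isTree_le_of_le_of_isAcyclic le_top h
  rw [← hT.card_edgeFinset, Nat.lt_succ_iff]
  exact card_le_card (edgeFinset_mono hGT)

theorem IsRegularOfDegree.card_dart_fst [Fintype G.Dart] [DecidableEq V] [Finite V]
    [G.LocallyFinite] {k : ℕ} (h : G.IsRegularOfDegree k) (x : V) :
    #{d : G.Dart | d.fst = x} = k := by
  classical
  cases nonempty_fintype V
  rw [← h x]
  convert G.dart_fst_fiber_card_eq_degree x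

/-- Of the `3 * #X` darts that start in `X`, at most `2 * (#X - 1)` stay inside, because `X` induces
a forest. The others have distinct edges in `A`. -/
theorem IsRegularOfDegree.card_add_two_le_of_isAcyclic_induce [Finite V] [G.LocallyFinite]
    (hcubic : G.IsRegularOfDegree 3) {X : Finset V} (hX : X.Nonempty)
    (hac : (G.induce (X : Set V)).IsAcyclic) {A : Finset (Sym2 V)}
    (hA : ∀ d : G.Dart, d.fst ∈ X → d.snd ∉ X → d.edge ∈ A) : #X + 2 ≤ #A := by
  classical
  cases nonempty_fintype V
  have : Nonempty (X : Set V) := hX.to_subtype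
  have h1 := hac.card_edgeFinset_lt
  have h2 := (G.induce (X : Set V)).dart_card_eq_twice_card_edges
  have h3 : #{d : G.Dart | d.fst ∈ X} = 3 * #X := by
    rw [card_eq_sum_card_fiberwise (f := fun d : G.Dart => d.fst) (t := X)
      (fun d hd => by simpa using hd)]
    rw [sum_congr rfl (g := fun _ => 3), sum_const, smul_eq_mul, mul_comm]
    intro x hx
    rw [← hcubic.card_dart_fst x]
    congr 1
    ext d
    simp only [mem_filter, mem_univ, true_and]
    exact ⟨fun h => h.2, fun h => ⟨h ▸ hx, h⟩⟩
  have h4 := card_filter_add_card_filter_not (s := ({d : G.Dart | d.fst ∈ X} : Finset G.Dart))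
    (fun d => d.snd ∈ X)
  have h5 : #({d ∈ ({d : G.Dart | d.fst ∈ X} : Finset G.Dart) | d.snd ∉ X}) ≤ #A := by
    refine card_le_card_of_injOn Dart.edge (fun d hd => ?_) fun d hd d' hd' hdd' => ?_
    · simp only [coe_filter, mem_filter, mem_univ, true_and, Set.mem_ofPred_eq] at hd
      exact hA d hd.1 hd.2
    · simp only [coe_filter, mem_filter, mem_univ, true_and, Set.mem_ofPred_eq] at hd hd'
      rcases (dart_edge_eq_iff d d').1 hdd' with h | rfl
      · exact h
      · exact (hd.2 hd'.1).elim
  have h6 : #({d ∈ ({d : G.Dart | d.fst ∈ X} : Finset G.Dart) | d.snd ∈ X}) ≤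
      Fintype.card (G.induce (X : Set V)).Dart := by
    rw [← Fintype.card_coe]
    refine Fintype.card_le_of_injective
      (fun d => ⟨(⟨d.1.fst, ?_⟩, ⟨d.1.snd, ?_⟩), d.1.adj⟩) fun d d' hdd' => ?_
    · have := d.2; simp only [mem_filter] at this; exact this.1.2
    · have := d.2; simp only [mem_filter] at this; exact this.2
    · rw [Dart.ext_iff, Prod.ext_iff] at hdd'
      refine Subtype.ext (Dart.ext _ _ (Prod.ext ?_ ?_))
      · exact congrArg Subtype.val hdd'.1
      · exact congrArg Subtype.val hdd'.2
  have h7 : Fintype.card (X : Set V) = #X := by simp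
  omega

/-- Cycles on both sides of the cut would survive in `G \ A`, where no walk changes sides. -/
theorem CyclicallyEdgeConnected.isAcyclic_induce_or {k : ℕ} (hcyc : G.CyclicallyEdgeConnected k)
    {A : Finset (Sym2 V)} (hAG : (A : Set (Sym2 V)) ⊆ G.edgeSet) (hk : #A < k) {X : Set V}
    (hX : ∀ d : G.Dart, d.edge ∈ A ↔ ¬ (d.fst ∈ X ↔ d.snd ∈ X)) :
    (G.induce X).IsAcyclic ∨ (G.induce Xᶜ).IsAcyclic := by
  by_contra hcon
  simp only [not_or, IsAcyclic, not_forall, not_not] at hcon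
  obtain ⟨⟨x, p, hp⟩, y, q, hq⟩ := hcon
  have hom : ∀ Y : Set V, (∀ d : G.Dart, d.fst ∈ Y → d.snd ∈ Y → d.edge ∉ A) →
      ∃ f : G.induce Y →g G.deleteEdges (A : Set (Sym2 V)), ∀ z, f z = z := fun Y hY =>
    ⟨⟨Subtype.val, fun {a b} hab => by
      rw [deleteEdges_adj]
      exact ⟨hab, hY ⟨(a, b), hab⟩ a.2 b.2⟩⟩, fun _ => rfl⟩
  obtain ⟨f, hf⟩ := hom X fun d h1 h2 hd => (hX d).1 hd (iff_of_true h1 h2)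
  obtain ⟨g, hg⟩ := hom Xᶜ fun d h1 h2 hd => (hX d).1 hd (iff_of_false h1 h2)
  have hfi : Function.Injective f := fun a b h => Subtype.ext (by rwa [hf, hf] at h)
  have hgi : Function.Injective g := fun a b h => Subtype.ext (by rwa [hg, hg] at h)
  refine hcyc A hAG hk ⟨_, _, p.map f, q.map g, (Walk.isCycle_map_iff_of_injective hfi).2 hp,
    (Walk.isCycle_map_iff_of_injective hgi).2 hq, fun h => ?_⟩
  obtain ⟨r⟩ := ConnectedComponent.exact h
  have key : ∀ (a b : V) (_ : (G.deleteEdges (A : Set (Sym2 V))).Walk a b), a ∈ X → b ∈ X := by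
    intro a b r
    induction r with
    | nil => exact id
    | cons hadj r ih =>
      intro ha
      rw [deleteEdges_adj] at hadj
      have := mt (hX ⟨(_, _), hadj.1⟩).2 hadj.2
      rw [not_not] at this
      exact ih (this.1 ha)
  have := key _ _ r (by rw [hf]; exact x.2)
  rw [hg] at this
  exact y.2 this

/-- `ρ` is a rotation system of a cubic and cyclically `5`-edge-connected graph that describes an
embedding on the sphere. -/
structure RotationSystem.IsCubicFive [G.LocallyFinite] (ρ : G.RotationSystem) : Prop where
  connected : G.Connected
  cubic : G.IsRegularOfDegree 3
  cyclic : G.CyclicallyEdgeConnected 5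
  planar : ρ.IsPlanar

/-- A closed walk of length `r ≤ 4` in the dual graph crosses the boundary of a set of at most
`r - 2` vertices. -/
theorem RotationSystem.IsCubicFive.exists_finset_of_closed [Finite V] [G.LocallyFinite]
    {ρ : G.RotationSystem} (h : ρ.IsCubicFive) {r : ℕ} [NeZero r] (hr : r ≤ 4)
    (t : Fin r → G.Dart) (ht : Function.Injective fun i => (t i).edge) (π : Equiv.Perm (Fin r))
    (hπ : ∀ i, ρ.dartFace (t i).symm = ρ.dartFace (t (π i))) :
    ∃ X : Finset V, X.Nonempty ∧ #X + 2 ≤ r ∧ ∀ i, ∃ x ∈ X, x ∈ (t i).edge := by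
  classical
  cases nonempty_fintype V
  set A : Finset (Sym2 V) := univ.image fun i => (t i).edge with hA
  have hAr : #A = r := by rw [hA, card_image_of_injective _ ht, card_univ, Fintype.card_fin]
  have hAG : (A : Set (Sym2 V)) ⊆ G.edgeSet := by
    intro e he
    simp only [hA, coe_image, Set.mem_image] at he
    obtain ⟨i, -, rfl⟩ := he
    exact (t i).edge_mem
  have hcount : ∀ e, (if e ∈ A then (1 : ZMod 2) else 0) =
      ∑ i, if e = (t i).edge then 1 else 0 := by
    intro e
    by_cases he : e ∈ A
    · obtain ⟨i, -, rfl⟩ := mem_image.1 he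
      rw [if_pos he, sum_eq_single i]
      · simp
      · exact fun j _ hj => if_neg fun hij => hj (ht hij.symm)
      · simp
    · rw [if_neg he, sum_eq_zero]
      exact fun i _ => if_neg fun hi => he (mem_image.2 ⟨i, mem_univ i, hi.symm⟩)
  -- By `π`, each face lies equally often on the two sides of the darts `t i`, so the indicator of
  -- `A` has even sum over every facial walk.
  obtain ⟨g, hg⟩ := h.planar.exists_cut h.connected (fun e => if e ∈ A then 1 else 0) (by
    intro f
    have hface : ∀ s : G.Dart, (∑ d : G.Dart, if ρ.dartFace d = f then
        (if d.edge = s.edge then (1 : ZMod 2) else 0) else 0) =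
        (if ρ.dartFace s = f then 1 else 0) + (if ρ.dartFace s.symm = f then 1 else 0) := by
      intro s
      rw [← sum_pair s.symm_ne.symm (f := fun s => if ρ.dartFace s = f then (1 : ZMod 2) else 0),
        ← sum_subset (subset_univ {s, s.symm})]
      · refine sum_congr rfl fun d hd => ?_
        have : d.edge = s.edge := by simpa [dart_edge_eq_iff] using hd
        rw [if_pos this]
      · intro d _ hd
        have : d.edge ≠ s.edge := by simpa [dart_edge_eq_iff] using hd
        rw [if_neg this, ite_self]
    simp only [hcount]
    rw [← sum_filter, sum_comm]
    simp only [sum_filter, hface, hπ]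
    rw [sum_add_distrib, Equiv.sum_comp π fun i => if ρ.dartFace (t i) = f then (1 : ZMod 2) else 0]
    exact CharTwo.add_self_eq_zero _)
  have hgA : ∀ d : G.Dart, d.edge ∈ A ↔ ¬ (g d.fst = 0 ↔ g d.snd = 0) := by
    intro d
    have := hg d
    have h2 : ∀ a b : ZMod 2, a + b = 1 ↔ ¬ (a = 0 ↔ b = 0) := by decide
    rw [← h2, ← this]
    simp
  have side : ∀ X : Finset V, (G.induce (X : Set V)).IsAcyclic →
      (∀ d : G.Dart, d.edge ∈ A ↔ ¬ (d.fst ∈ X ↔ d.snd ∈ X)) →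
      ∃ X : Finset V, X.Nonempty ∧ #X + 2 ≤ r ∧ ∀ i, ∃ x ∈ X, x ∈ (t i).edge := by
    intro X hac hX
    have hmem : ∀ i, ∃ x ∈ X, x ∈ (t i).edge := by
      intro i
      have := (hX (t i)).1 (mem_image_of_mem _ (mem_univ i))
      by_cases h1 : (t i).fst ∈ X
      · exact ⟨_, h1, Sym2.mem_mk_left _ _⟩
      · exact ⟨_, by tauto, Sym2.mem_mk_right _ _⟩
    have hne : X.Nonempty := (hmem 0).imp fun x hx => hx.1
    refine ⟨X, hne, ?_, hmem⟩
    rw [← hAr]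
    exact h.cubic.card_add_two_le_of_isAcyclic_induce hne hac fun d h1 h2 => (hX d).2 (by tauto)
  rcases h.cyclic.isAcyclic_induce_or hAG (by omega) (X := {x | g x = 0}) hgA with hac | hac
  · exact side ({x | g x = 0} : Finset V) (by rwa [coe_filter_univ]) fun d => by
      rw [hgA]; simp
  · refine side ({x | g x ≠ 0} : Finset V) ?_ fun d => ?_
    · have : ((({x | g x ≠ 0} : Finset V)) : Set V) = {x | g x = 0}ᶜ := by ext; simp
      rwa [this]
    · rw [hgA]; simp only [mem_filter, mem_univ, true_and]; tauto

end Cuts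

end SimpleGraph

/-! ### Local structure: faces at a vertex, dual triangles and quadrangles -/

namespace SimpleGraph

namespace RotationSystem

variable {V : Type*} {G : SimpleGraph V} (ρ : G.RotationSystem)

/-- The face `f` is incident with the vertex `x`. -/
def FaceAt (x : V) (f : ρ.untwisted.Face) : Prop := ∃ d : G.Dart, d.fst = x ∧ ρ.dartFace d = f

variable {ρ}

theorem faceAt_fst (d : G.Dart) : ρ.FaceAt d.fst (ρ.dartFace d) := ⟨d, rfl, rfl⟩

theorem faceAt_snd (d : G.Dart) : ρ.FaceAt d.snd (ρ.dartFace d) :=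
  ⟨ρ.faceNext d, ρ.fst_faceNext d, ρ.dartFace_faceNext d⟩

theorem faceAt_of_mem_edge {x : V} {d : G.Dart} (h : x ∈ d.edge) : ρ.FaceAt x (ρ.dartFace d) := by
  rcases Sym2.mem_iff.1 h with rfl | rfl
  exacts [faceAt_fst d, faceAt_snd d]

theorem faceAt_symm_of_mem_edge {x : V} {d : G.Dart} (h : x ∈ d.edge) :
    ρ.FaceAt x (ρ.dartFace d.symm) :=
  faceAt_of_mem_edge (by rwa [Dart.edge_symm])

namespace IsCubicFive

variable [Finite V] [G.LocallyFinite] (h : ρ.IsCubicFive)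

include h

/-- The rotation is transitive on the three darts at a vertex, so an orbit of length one or two is
too small. -/
theorem next_eq_cases (d : G.Dart) :
    ρ.next d ≠ d ∧ ρ.next (ρ.next (ρ.next d)) = d ∧
      ∀ d' : G.Dart, d'.fst = d.fst → d' = d ∨ d' = ρ.next d ∨ d' = ρ.next (ρ.next d) := by
  classical
  cases nonempty_fintype V
  have hcard := h.cubic.card_dart_fst d.fst
  have h1 : ρ.next d ≠ d := by
    intro h1
    have hsub : ({d' : G.Dart | d'.fst = d.fst} : Finset G.Dart) ⊆ {d} := by
      intro d' hd'
      have := ρ.sameCycle d d' (by simpa [eq_comm] using hd')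
      simpa [eq_comm] using this.eq_of_left h1
    have := Finset.card_le_card hsub
    rw [hcard, Finset.card_singleton] at this
    omega
  have h2 : ρ.next (ρ.next d) ≠ d := by
    intro h2
    have hsub : ({d' : G.Dart | d'.fst = d.fst} : Finset G.Dart) ⊆ {d, ρ.next d} := by
      intro d' hd'
      have := (ρ.sameCycle d d' (by simpa [eq_comm] using hd')).map_eq
        (g := fun z => z = d ∨ z = ρ.next d) fun z => by
          rw [ρ.next.injective.eq_iff, ← h2, ρ.next.injective.eq_iff, h2, or_comm]
      simpa using this
    have := (Finset.card_le_card hsub).trans Finset.card_le_two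
    omega
  have hsub : ({d, ρ.next d, ρ.next (ρ.next d)} : Finset G.Dart) ⊆
      ({d' : G.Dart | d'.fst = d.fst} : Finset G.Dart) := by
    intro d' hd'
    simp only [Finset.mem_insert, Finset.mem_singleton] at hd'
    rcases hd' with rfl | rfl | rfl <;> simp [ρ.fst_next]
  have h3 : ({d, ρ.next d, ρ.next (ρ.next d)} : Finset G.Dart).card = 3 :=
    Finset.card_eq_three.2 ⟨_, _, _, h1.symm, h2.symm, fun h3 => h1 (ρ.next.injective h3).symm, rfl⟩
  have heq := Finset.eq_of_subset_of_card_le hsub (by rw [hcard, h3])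
  have hcases : ∀ d' : G.Dart, d'.fst = d.fst →
      d' = d ∨ d' = ρ.next d ∨ d' = ρ.next (ρ.next d) := by
    intro d' hd'
    have : d' ∈ ({d' : G.Dart | d'.fst = d.fst} : Finset G.Dart) := by simpa using hd'
    rw [← heq] at this
    simpa using this
  refine ⟨h1, ?_, hcases⟩
  rcases hcases (ρ.next (ρ.next (ρ.next d))) (by simp [ρ.fst_next]) with h4 | h4 | h4
  · exact h4
  · exact (h2 (ρ.next.injective h4)).elim
  · exact (h1 (ρ.next.injective (ρ.next.injective h4))).elim

theorem next_ne (d : G.Dart) : ρ.next d ≠ d := (h.next_eq_cases d).1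

theorem next_next_next (d : G.Dart) : ρ.next (ρ.next (ρ.next d)) = d := (h.next_eq_cases d).2.1

theorem eq_cases_of_fst_eq {d d' : G.Dart} (hd : d'.fst = d.fst) :
    d' = d ∨ d' = ρ.next d ∨ d' = ρ.next (ρ.next d) := (h.next_eq_cases d).2.2 d' hd

/-- A dual loop is a closed walk of length `r = 1`, and no nonempty set has at most `r - 2`
vertices. -/
theorem dartFace_symm_ne (d : G.Dart) : ρ.dartFace d.symm ≠ ρ.dartFace d := by
  intro hd
  obtain ⟨X, hX, hcard, -⟩ := h.exists_finset_of_closed (r := 1) (by omega) (fun _ => d)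
    (fun i j _ => Subsingleton.elim i j) 1 fun _ => hd
  have := hX.card_pos
  omega

/-- A face passes a vertex only once: consecutive darts of the rotation lie on the two sides of an
edge, and all pairs of darts at a cubic vertex are consecutive. -/
theorem eq_of_dartFace_eq_of_fst_eq {d d' : G.Dart} (hf : ρ.dartFace d = ρ.dartFace d')
    (hd : d.fst = d'.fst) : d = d' := by
  rcases h.eq_cases_of_fst_eq hd with rfl | rfl | rfl
  · rfl
  · rw [dartFace_next] at hf
    exact (h.dartFace_symm_ne _ hf).elim
  · have := h.dartFace_symm_ne (ρ.next (ρ.next d'))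
    rw [← dartFace_next, h.next_next_next] at this
    exact (this hf.symm).elim

/-- Two faces share at most one edge, since a dual digon is excluded by the case `r = 2`. -/
theorem eq_of_dartFace_eq {d d' : G.Dart} (hf : ρ.dartFace d = ρ.dartFace d')
    (hf' : ρ.dartFace d.symm = ρ.dartFace d'.symm) : d = d' := by
  by_contra hne
  have hne' : d.edge ≠ d'.edge := by
    rw [Ne, dart_edge_eq_iff]
    rintro (rfl | rfl)
    · exact hne rfl
    · exact h.dartFace_symm_ne _ hf
  obtain ⟨X, hX, hcard, -⟩ := h.exists_finset_of_closed (r := 2) (by omega) ![d, d'.symm]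
    (by
      intro i j hij
      fin_cases i <;> fin_cases j <;> simp_all [eq_comm])
    (Equiv.addRight 1) (by
      intro i
      fin_cases i <;> simp_all)
  have := hX.card_pos
  omega

/-- The boundary edges of three pairwise adjacent faces share a vertex. -/
theorem exists_mem_of_triangle {d₁ d₂ d₃ : G.Dart} (h₁ : ρ.dartFace d₁.symm = ρ.dartFace d₂)
    (h₂ : ρ.dartFace d₂.symm = ρ.dartFace d₃) (h₃ : ρ.dartFace d₃.symm = ρ.dartFace d₁) :
    ∃ x, x ∈ d₁.edge ∧ x ∈ d₂.edge ∧ x ∈ d₃.edge := by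
  have key : ∀ {d d' d'' : G.Dart}, ρ.dartFace d.symm = ρ.dartFace d' →
      ρ.dartFace d'.symm = ρ.dartFace d'' → ρ.dartFace d''.symm = ρ.dartFace d →
      d.edge ≠ d'.edge := by
    intro d d' d'' h1 h2 h3
    rw [Ne, dart_edge_eq_iff]
    rintro (rfl | rfl)
    · exact h.dartFace_symm_ne _ h1
    · exact h.dartFace_symm_ne d'' (h3.trans h2)
  have e₁ := key h₁ h₂ h₃
  have e₂ := key h₂ h₃ h₁
  have e₃ := key h₃ h₁ h₂
  obtain ⟨X, ⟨x, hx⟩, hcard, hX⟩ := h.exists_finset_of_closed (r := 3) (by omega) ![d₁, d₂, d₃]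
    (by
      intro i j hij
      fin_cases i <;> fin_cases j <;> simp_all [eq_comm])
    (Equiv.addRight 1) (by
      intro i
      fin_cases i <;> simpa)
  have hall : ∀ y ∈ X, y = x := fun y hy => Finset.card_le_one.1 (by omega) y hy x hx
  have hmem : ∀ i, x ∈ (![d₁, d₂, d₃] i).edge := fun i => by
    obtain ⟨y, hy, hyi⟩ := hX i
    rwa [hall y hy] at hyi
  exact ⟨x, hmem 0, hmem 1, hmem 2⟩

/-- The four edges that are crossed by a cycle of length four of the dual graph are covered by two
vertices. -/
theorem exists_mem_of_quadrangle {d₁ d₂ d₃ d₄ : G.Dart}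
    (h₁ : ρ.dartFace d₁.symm = ρ.dartFace d₂) (h₂ : ρ.dartFace d₂.symm = ρ.dartFace d₃)
    (h₃ : ρ.dartFace d₃.symm = ρ.dartFace d₄) (h₄ : ρ.dartFace d₄.symm = ρ.dartFace d₁)
    (h₁₃ : ρ.dartFace d₁ ≠ ρ.dartFace d₃) (h₂₄ : ρ.dartFace d₂ ≠ ρ.dartFace d₄) :
    ∃ x y, (x ∈ d₁.edge ∨ y ∈ d₁.edge) ∧ (x ∈ d₂.edge ∨ y ∈ d₂.edge) ∧
      (x ∈ d₃.edge ∨ y ∈ d₃.edge) ∧ (x ∈ d₄.edge ∨ y ∈ d₄.edge) := by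
  have key : ∀ {d d' : G.Dart}, ρ.dartFace d.symm = ρ.dartFace d' →
      ρ.dartFace d ≠ ρ.dartFace d'.symm → d.edge ≠ d'.edge := by
    intro d d' h1 h2
    rw [Ne, dart_edge_eq_iff]
    rintro (rfl | rfl)
    · exact h.dartFace_symm_ne _ h1
    · exact h2 rfl
  have key' : ∀ {d d' : G.Dart}, ρ.dartFace d ≠ ρ.dartFace d' →
      ρ.dartFace d.symm ≠ ρ.dartFace d' → d.edge ≠ d'.edge := by
    intro d d' h1 h2
    rw [Ne, dart_edge_eq_iff]
    rintro (rfl | rfl)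
    · exact h1 rfl
    · exact h2 (by simp)
  have n₁ := h.dartFace_symm_ne d₁
  have n₂ := h.dartFace_symm_ne d₂
  have n₃ := h.dartFace_symm_ne d₃
  have n₄ := h.dartFace_symm_ne d₄
  have e₁₂ := key h₁ (h₂ ▸ h₁₃)
  have e₂₃ := key h₂ (h₃ ▸ h₂₄)
  have e₃₄ := key h₃ (h₄ ▸ h₁₃.symm)
  have e₄₁ := key h₄ (h₁ ▸ h₂₄.symm)
  have e₁₃ := key' h₁₃ (h₁ ▸ h₂ ▸ n₂.symm)
  have e₂₄ := key' h₂₄ (h₂ ▸ h₃ ▸ n₃.symm)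
  obtain ⟨X, hne, hcard, hX⟩ := h.exists_finset_of_closed (r := 4) le_rfl ![d₁, d₂, d₃, d₄]
    (by
      intro i j hij
      fin_cases i <;> fin_cases j <;> simp_all [eq_comm])
    (Equiv.addRight 1) (by
      intro i
      fin_cases i <;> simpa)
  obtain ⟨x, y, hxy⟩ : ∃ x y, ∀ z ∈ X, z = x ∨ z = y := by
    have := hne.card_pos
    obtain hc | hc : X.card = 1 ∨ X.card = 2 := by omega
    · obtain ⟨x, rfl⟩ := Finset.card_eq_one.1 hc
      exact ⟨x, x, by simp⟩
    · classical
      obtain ⟨x, y, -, rfl⟩ := Finset.card_eq_two.1 hc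
      exact ⟨x, y, by simp⟩
  have hmem : ∀ i, x ∈ (![d₁, d₂, d₃, d₄] i).edge ∨ y ∈ (![d₁, d₂, d₃, d₄] i).edge := fun i => by
    obtain ⟨z, hz, hzi⟩ := hX i
    rcases hxy z hz with rfl | rfl
    exacts [Or.inl hzi, Or.inr hzi]
  exact ⟨x, y, hmem 0, hmem 1, hmem 2, hmem 3⟩

theorem faceAt_iff (d : G.Dart) (f : ρ.untwisted.Face) :
    ρ.FaceAt d.fst f ↔
      f = ρ.dartFace d ∨ f = ρ.dartFace d.symm ∨ f = ρ.dartFace (ρ.next d).symm := by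
  simp only [← dartFace_next]
  constructor
  · rintro ⟨d', hd', rfl⟩
    rcases h.eq_cases_of_fst_eq hd' with rfl | rfl | rfl <;> simp
  · rintro (rfl | rfl | rfl)
    exacts [⟨_, rfl, rfl⟩, ⟨_, ρ.fst_next d, rfl⟩, ⟨_, by simp [ρ.fst_next], rfl⟩]

theorem faceAt_cases {x : V} {a b c f : ρ.untwisted.Face} (ha : ρ.FaceAt x a) (hb : ρ.FaceAt x b)
    (hc : ρ.FaceAt x c) (hab : a ≠ b) (hac : a ≠ c) (hbc : b ≠ c) (hf : ρ.FaceAt x f) :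
    f = a ∨ f = b ∨ f = c := by
  obtain ⟨d, rfl, -⟩ := id ha
  rw [h.faceAt_iff] at ha hb hc hf
  grind

/-- Two faces at a vertex are separated by an edge at this vertex. -/
theorem exists_dart_of_faceAt {x : V} {f f' : ρ.untwisted.Face} (hf : ρ.FaceAt x f)
    (hf' : ρ.FaceAt x f') (hne : f ≠ f') :
    ∃ d : G.Dart, x ∈ d.edge ∧ ρ.dartFace d = f ∧ ρ.dartFace d.symm = f' := by
  obtain ⟨d, rfl, rfl⟩ := hf
  obtain ⟨d', hd', rfl⟩ := hf'
  have hl : ∀ d : G.Dart, d.fst ∈ d.edge := fun d => Sym2.mem_mk_left _ _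
  rcases h.eq_cases_of_fst_eq hd' with rfl | rfl | rfl
  · exact (hne rfl).elim
  · exact ⟨d, hl d, rfl, (ρ.dartFace_next d).symm⟩
  · refine ⟨(ρ.next (ρ.next d)).symm, ?_, ?_, by simp⟩
    · rw [Dart.edge_symm, ← hd']; exact hl _
    · rw [← dartFace_next, h.next_next_next]

end IsCubicFive

end RotationSystem

end SimpleGraph

/-! ### Neighbours of `v` and `w`, and edges between them -/

namespace SimpleGraph

namespace RotationSystem

variable {V : Type*} {G : SimpleGraph V} (ρ : G.RotationSystem)

/-- The vertices of `G` on the boundary of one of the faces `v` and `w`. -/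
def NearVertex (v w : ρ.untwisted.Face) (x : V) : Prop := ρ.FaceAt x v ∨ ρ.FaceAt x w

/-- The faces different from `v` and `w` that are adjacent to one of them. -/
def RingFace (v w f : ρ.untwisted.Face) : Prop :=
  f ≠ v ∧ f ≠ w ∧ (ρ.untwisted.dualGraph.Adj v f ∨ ρ.untwisted.dualGraph.Adj w f)

/-- The face on the other side of the `i`-th edge of the face of `d`, counted from `d`. -/
def nbrFace (d : G.Dart) (i : ℕ) : ρ.untwisted.Face := ρ.dartFace ((ρ.faceNext ^ i) d).symm

variable {ρ}

theorem RingFace.swap {v w f : ρ.untwisted.Face} (h : ρ.RingFace v w f) : ρ.RingFace w v f :=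
  ⟨h.2.1, h.1, h.2.2.symm⟩

theorem nearVertex_swap {v w : ρ.untwisted.Face} {x : V} :
    ρ.NearVertex w v x ↔ ρ.NearVertex v w x := or_comm

@[simp] theorem nbrFace_zero (d : G.Dart) : ρ.nbrFace d 0 = ρ.dartFace d.symm := rfl

theorem faceNext_pow_succ (d : G.Dart) (i : ℕ) :
    (ρ.faceNext ^ (i + 1)) d = ρ.faceNext ((ρ.faceNext ^ i) d) := by
  rw [pow_succ', Equiv.Perm.mul_apply]

theorem exists_faceNext_pow_eq [Finite G.Dart] {d d' : G.Dart}
    (hd : ρ.dartFace d = ρ.dartFace d') :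
    ∃ i < (ρ.dartFace d).length, (ρ.faceNext ^ i) d = d' := by
  rw [length_dartFace]
  obtain ⟨n, -, hn⟩ := (ρ.dartFace_eq_iff.1 hd).exists_pow_eq'
  refine ⟨n % Function.minimalPeriod ρ.faceNext d, Nat.mod_lt _ ?_, ?_⟩
  · exact Function.minimalPeriod_pos_of_mem_periodicPts
      (ρ.faceNext.injective.mem_periodicPts d)
  · rw [Equiv.Perm.coe_pow, Function.iterate_mod_minimalPeriod_eq, ← Equiv.Perm.coe_pow, hn]

theorem faceNext_pow_length (d : G.Dart) : (ρ.faceNext ^ (ρ.dartFace d).length) d = d := by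
  rw [length_dartFace, Equiv.Perm.coe_pow]
  exact Function.iterate_minimalPeriod

theorem faceNext_pow_injOn (d : G.Dart) {i j : ℕ} (hi : i < (ρ.dartFace d).length)
    (hj : j < (ρ.dartFace d).length) (hij : (ρ.faceNext ^ i) d = (ρ.faceNext ^ j) d) : i = j := by
  rw [length_dartFace] at hi hj
  rw [Equiv.Perm.coe_pow, Equiv.Perm.coe_pow] at hij
  exact Function.iterate_injOn_Iio_minimalPeriod hi hj hij

theorem adj_dartFace_iff [Finite G.Dart] {d : G.Dart} {f : ρ.untwisted.Face} :
    ρ.untwisted.dualGraph.Adj (ρ.dartFace d) f ↔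
      ρ.dartFace d ≠ f ∧ ∃ i < (ρ.dartFace d).length, ρ.nbrFace d i = f := by
  rw [dualGraph_adj]
  refine and_congr_right fun _ => ⟨?_, ?_⟩
  · rintro ⟨e, he, rfl⟩
    obtain ⟨i, hi, rfl⟩ := exists_faceNext_pow_eq he.symm
    exact ⟨i, hi, rfl⟩
  · rintro ⟨i, -, rfl⟩
    exact ⟨_, ρ.dartFace_faceNext_pow i d, rfl⟩

theorem adj_of_faces {d : G.Dart} {f f' : ρ.untwisted.Face} (hne : f ≠ f')
    (h : ρ.dartFace d = f) (h' : ρ.dartFace d.symm = f') : ρ.untwisted.dualGraph.Adj f f' :=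
  ρ.dualGraph_adj.2 ⟨hne, d, h, h'⟩

namespace IsCubicFive

variable [Finite V] [G.LocallyFinite] (h : ρ.IsCubicFive)

include h

/-- The dart `ρ.next (ρ.faceNext a)` is the third one at the head of `a`. It leaves the face of `a`
and separates the faces across `a` and across `ρ.faceNext a`. -/
theorem dartFace_next_faceNext_symm (a : G.Dart) :
    ρ.dartFace (ρ.next (ρ.faceNext a)).symm = ρ.dartFace a.symm := by
  rw [← dartFace_next, faceNext_apply, h.next_next_next]

theorem nbrFace_ne (d : G.Dart) (i : ℕ) : ρ.nbrFace d i ≠ ρ.dartFace d := by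
  have := h.dartFace_symm_ne ((ρ.faceNext ^ i) d)
  rwa [dartFace_faceNext_pow] at this

theorem nbrFace_of_succ_eq_length {d : G.Dart} {i : ℕ} (hi : i + 1 = (ρ.dartFace d).length) :
    ρ.nbrFace d i = ρ.nbrFace d.symm 1 := by
  have := h.dartFace_next_faceNext_symm ((ρ.faceNext ^ i) d)
  rw [← faceNext_pow_succ, hi, faceNext_pow_length] at this
  rw [nbrFace, ← this, nbrFace, pow_one, next_faceNext_symm]

theorem nbrFace_injOn (d : G.Dart) {i j : ℕ} (hi : i < (ρ.dartFace d).length)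
    (hj : j < (ρ.dartFace d).length) (hij : ρ.nbrFace d i = ρ.nbrFace d j) : i = j :=
  faceNext_pow_injOn d hi hj (h.eq_of_dartFace_eq (by simp) hij)

/-- Two edges of a face that share a vertex are consecutive. -/
theorem faceNext_eq_or {a b : G.Dart} (hab : a ≠ b) (hf : ρ.dartFace a = ρ.dartFace b) {z : V}
    (ha : z ∈ a.edge) (hb : z ∈ b.edge) : ρ.faceNext a = b ∨ ρ.faceNext b = a := by
  rcases Sym2.mem_iff.1 ha with rfl | rfl <;> rcases Sym2.mem_iff.1 hb with hz | hz
  · exact (hab (h.eq_of_dartFace_eq_of_fst_eq hf hz)).elim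
  · exact Or.inr (h.eq_of_dartFace_eq_of_fst_eq (by simp [hf]) (by simp [hz]))
  · exact Or.inl (h.eq_of_dartFace_eq_of_fst_eq (by simp [hf]) (by simp [hz]))
  · exact (hab (ρ.faceNext.injective
      (h.eq_of_dartFace_eq_of_fst_eq (by simp [hf]) (by simp [hz])))).elim

/-- A common neighbour of the two faces along `d` forms a dual triangle with them, so it sits at an
end of `d`. -/
theorem nbrFace_eq_nbrFace_symm {d : G.Dart} {i j : ℕ} (hi0 : 0 < i) (hj0 : 0 < j)
    (hi : i < (ρ.dartFace d).length) (hj : j < (ρ.dartFace d.symm).length)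
    (hij : ρ.nbrFace d i = ρ.nbrFace d.symm j) :
    (i = 1 ∧ j + 1 = (ρ.dartFace d.symm).length) ∨ (i + 1 = (ρ.dartFace d).length ∧ j = 1) := by
  obtain ⟨x, hx, -, hx'⟩ := h.exists_mem_of_triangle (d₁ := d) (d₂ := (ρ.faceNext ^ j) d.symm)
    (d₃ := ((ρ.faceNext ^ i) d).symm) (by simp) hij.symm (by simp)
  rw [Dart.edge_symm] at hx'
  have hne : d ≠ (ρ.faceNext ^ i) d := fun hd =>
    hi0.ne (faceNext_pow_injOn d (i := 0) (by omega) hi (by simpa using hd))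
  rcases h.faceNext_eq_or hne (by simp) hx hx' with hd | hd
  · have hi1 : i = 1 := faceNext_pow_injOn d (j := 1) hi (by omega) (by rw [pow_one, hd])
    subst hi1
    have h1 := h.nbrFace_of_succ_eq_length (d := d.symm)
      (i := (ρ.dartFace d.symm).length - 1) (by omega)
    rw [Dart.symm_symm, hij] at h1
    have := h.nbrFace_injOn d.symm (by omega) hj h1
    exact Or.inl ⟨rfl, by omega⟩
  · have hi1 : i + 1 = (ρ.dartFace d).length := by
      by_contra hcon
      have := faceNext_pow_injOn (ρ := ρ) d (i := i + 1) (j := 0) (by omega) (by omega)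
        (by rw [faceNext_pow_succ, hd]; rfl)
      omega
    have h1 := h.nbrFace_of_succ_eq_length hi1
    rw [hij] at h1
    exact Or.inr ⟨hi1, h.nbrFace_injOn d.symm (j := 1) hj (by omega) h1⟩

theorem not_nearVertex_iff_of_adj_of_adj {v w : ρ.untwisted.Face} {t : G.Dart}
    (hvw : ρ.untwisted.dualGraph.Adj v w) (hv : 4 ≤ v.length)
    (h₁ : ρ.untwisted.dualGraph.Adj v (ρ.dartFace t)) (h₁w : ρ.dartFace t ≠ w)
    (h₂ : ρ.untwisted.dualGraph.Adj v (ρ.dartFace t.symm)) (h₂w : ρ.dartFace t.symm ≠ w) :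
    ¬ (ρ.NearVertex v w t.fst ↔ ρ.NearVertex v w t.snd) := by
  obtain ⟨hne, d, hd, hd'⟩ := ρ.dualGraph_adj.1 hvw
  obtain ⟨hne₁, a, ha, ha'⟩ := ρ.dualGraph_adj.1 h₁
  obtain ⟨hne₂, b, hb, hb'⟩ := ρ.dualGraph_adj.1 h₂
  have htt := h.dartFace_symm_ne t
  obtain ⟨x, hxa, hxt, hxb⟩ := h.exists_mem_of_triangle (d₁ := a) (d₂ := t) (d₃ := b.symm) ha'
    hb'.symm (by rw [Dart.symm_symm, hb, ha])
  rw [Dart.edge_symm] at hxb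
  have hxv : ρ.FaceAt x v := ha ▸ faceAt_of_mem_edge hxa
  -- The far end `y` of `t` cannot lie on `v`, as the unique edge `a` between `v` and `ρ.dartFace t`
  -- would then be `t` itself. If it lay on `w`, both ring faces would be adjacent to `w` as well.
  have key : ∀ y, t.edge = s(x, y) → ¬ ρ.NearVertex v w y := by
    intro y hxy hy
    have hyt : y ∈ t.edge := hxy ▸ Sym2.mem_mk_right x y
    have hxne : x ≠ y := by
      rintro rfl
      have := t.edge_mem
      rw [hxy] at this
      exact G.loopless.irrefl x this
    have hy₁ : ρ.FaceAt y (ρ.dartFace t) := faceAt_of_mem_edge hyt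
    have hy₂ : ρ.FaceAt y (ρ.dartFace t.symm) := faceAt_symm_of_mem_edge hyt
    rcases hy with hy | hy
    · obtain ⟨e, hye, he, he'⟩ := h.exists_dart_of_faceAt hy hy₁ hne₁
      obtain rfl : e = a := h.eq_of_dartFace_eq (he.trans ha.symm) (he'.trans ha'.symm)
      have : e.edge = t.edge := ((Sym2.mem_and_mem_iff hxne).1 ⟨hxa, hye⟩).trans hxy.symm
      rcases (dart_edge_eq_iff _ _).1 this with rfl | rfl
      · exact hne₁ he.symm
      · exact hne₂ he.symm
    · obtain ⟨e₁, hye₁, he₁, he₁'⟩ := h.exists_dart_of_faceAt hy hy₁ h₁w.symm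
      obtain ⟨e₂, hye₂, he₂, he₂'⟩ := h.exists_dart_of_faceAt hy hy₂ h₂w.symm
      obtain ⟨z₁, hz₁d, -, hz₁a⟩ := h.exists_mem_of_triangle (d₁ := d) (d₂ := e₁) (d₃ := a.symm)
        (hd'.trans he₁.symm) (he₁'.trans ha'.symm) (by rw [Dart.symm_symm, ha, hd])
      obtain ⟨z₂, hz₂d, -, hz₂b⟩ := h.exists_mem_of_triangle (d₁ := d) (d₂ := e₂) (d₃ := b.symm)
        (hd'.trans he₂.symm) (he₂'.trans hb'.symm) (by rw [Dart.symm_symm, hb, hd])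
      rw [Dart.edge_symm] at hz₁a hz₂b
      have hda : d ≠ a := by rintro rfl; exact h₁w (ha'.symm.trans hd')
      have hdb : d ≠ b := by rintro rfl; exact h₂w (hb'.symm.trans hd')
      have hab : a ≠ b := by rintro rfl; exact htt (hb'.symm.trans ha')
      -- The edges of `d`, `a` and `b` on `v` meet pairwise, hence are pairwise consecutive, and `v`
      -- would be a triangle.
      have h3 : (ρ.faceNext ^ 3) d = d := by
        simp only [faceNext_pow_succ, pow_zero, Equiv.Perm.one_apply]
        rcases h.faceNext_eq_or hda (hd.trans ha.symm) hz₁d hz₁a with e1 | e1 <;>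
        rcases h.faceNext_eq_or hdb (hd.trans hb.symm) hz₂d hz₂b with e2 | e2 <;>
        rcases h.faceNext_eq_or hab (ha.trans hb.symm) hxa hxb with e3 | e3 <;>
        grind
      rw [← hd] at hv
      have := faceNext_pow_injOn d (i := 3) (j := 0) (by omega) (by omega) h3
      omega
  rcases Sym2.mem_iff.1 hxt with rfl | rfl
  · exact fun hiff => key t.snd rfl (hiff.1 (Or.inl hxv))
  · exact fun hiff => key t.fst Sym2.eq_swap (hiff.2 (Or.inl hxv))

/-- If the two sides of an edge are two faces that are adjacent to `v` or `w`, then exactly one end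
of the edge is on the boundary of `v` or `w`. -/
theorem not_nearVertex_iff {v w : ρ.untwisted.Face} {t : G.Dart}
    (hvw : ρ.untwisted.dualGraph.Adj v w) (hv : 4 ≤ v.length) (hw : 4 ≤ w.length)
    (h₁ : ρ.RingFace v w (ρ.dartFace t)) (h₂ : ρ.RingFace v w (ρ.dartFace t.symm)) :
    ¬ (ρ.NearVertex v w t.fst ↔ ρ.NearVertex v w t.snd) := by
  have hvv : ρ.untwisted.dualGraph.Adj v (ρ.dartFace t) →
      ρ.untwisted.dualGraph.Adj v (ρ.dartFace t.symm) →
      ¬ (ρ.NearVertex v w t.fst ↔ ρ.NearVertex v w t.snd) := fun a₁ a₂ =>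
    h.not_nearVertex_iff_of_adj_of_adj hvw hv a₁ h₁.2.1 a₂ h₂.2.1
  have hww : ρ.untwisted.dualGraph.Adj w (ρ.dartFace t) →
      ρ.untwisted.dualGraph.Adj w (ρ.dartFace t.symm) →
      ¬ (ρ.NearVertex v w t.fst ↔ ρ.NearVertex v w t.snd) := fun a₁ a₂ => by
    have := h.not_nearVertex_iff_of_adj_of_adj hvw.symm hw a₁ h₁.1 a₂ h₂.1
    exact fun hiff => this (nearVertex_swap.trans (hiff.trans nearVertex_swap.symm))
  -- Two vertices cover the dual quadrangle of `v`, the two sides of `s`, and `w`. None lies on both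
  -- `a` and `b`, as it would be on four faces. So one lies on `a`, the other on `b`, and the one on
  -- `s` makes a side of `s` adjacent to both `v` and `w`.
  have mixed : ∀ s : G.Dart, ρ.RingFace v w (ρ.dartFace s) → ρ.RingFace v w (ρ.dartFace s.symm) →
      ρ.untwisted.dualGraph.Adj v (ρ.dartFace s) →
      ρ.untwisted.dualGraph.Adj w (ρ.dartFace s.symm) →
      ρ.untwisted.dualGraph.Adj v (ρ.dartFace s.symm) ∨
        ρ.untwisted.dualGraph.Adj w (ρ.dartFace s) := by
    intro s r₁ r₂ a₁ a₂
    obtain ⟨hne, d, hd, hd'⟩ := ρ.dualGraph_adj.1 hvw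
    obtain ⟨hne₁, a, ha, ha'⟩ := ρ.dualGraph_adj.1 a₁
    obtain ⟨hne₂, b, hb, hb'⟩ := ρ.dualGraph_adj.1 a₂
    have hss := h.dartFace_symm_ne s
    obtain ⟨x, y, c₁, c₂, c₃, -⟩ := h.exists_mem_of_quadrangle (d₁ := a) (d₂ := s) (d₃ := b.symm)
      (d₄ := d.symm) ha' hb'.symm (by rw [Dart.symm_symm, hb, hd'])
      (by rw [Dart.symm_symm, hd, ha]) (by rw [ha, hb']; exact r₂.1.symm)
      (by rw [hd']; exact r₁.2.1)
    rw [Dart.edge_symm] at c₃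
    have not_both : ∀ z, z ∈ a.edge → z ∈ b.edge → False := by
      intro z hza hzb
      have f₁ := faceAt_of_mem_edge (ρ := ρ) hza
      have f₂ := faceAt_symm_of_mem_edge (ρ := ρ) hza
      have f₃ := faceAt_of_mem_edge (ρ := ρ) hzb
      have f₄ := faceAt_symm_of_mem_edge (ρ := ρ) hzb
      rw [ha] at f₁
      rw [ha'] at f₂
      rw [hb] at f₃
      rw [hb'] at f₄
      rcases h.faceAt_cases f₁ f₂ f₃ hne₁ hne r₁.2.1 f₄ with e | e | e
      exacts [r₂.1 e, hss e, r₂.2.1 e]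
    have left : ∀ z, z ∈ s.edge → z ∈ a.edge →
        ρ.untwisted.dualGraph.Adj v (ρ.dartFace s.symm) := by
      intro z hzs hza
      obtain ⟨e, -, he, he'⟩ := h.exists_dart_of_faceAt (ha ▸ faceAt_of_mem_edge hza)
        (faceAt_symm_of_mem_edge hzs) r₂.1.symm
      exact adj_of_faces r₂.1.symm he he'
    have right : ∀ z, z ∈ s.edge → z ∈ b.edge → ρ.untwisted.dualGraph.Adj w (ρ.dartFace s) := by
      intro z hzs hzb
      obtain ⟨e, -, he, he'⟩ := h.exists_dart_of_faceAt (hb ▸ faceAt_of_mem_edge hzb)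
        (faceAt_of_mem_edge hzs) r₁.2.1.symm
      exact adj_of_faces r₁.2.1.symm he he'
    grind
  rcases h₁.2.2 with a₁ | a₁ <;> rcases h₂.2.2 with a₂ | a₂
  · exact hvv a₁ a₂
  · rcases mixed t h₁ h₂ a₁ a₂ with a | a
    exacts [hvv a₁ a, hww a a₂]
  · rcases mixed t.symm h₂ (by rwa [Dart.symm_symm]) a₂ (by rwa [Dart.symm_symm]) with a | a
    · rw [Dart.symm_symm] at a
      exact hvv a a₂
    · exact hww a₁ a
  · exact hww a₁ a₂

end IsCubicFive

end RotationSystem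

end SimpleGraph

/-! ### The cyclic enumeration of the ring faces -/

namespace SimpleGraph

namespace Walk

variable {α : Type*} {H : SimpleGraph α}

theorem exists_getVert_eq (c : ℕ → α) (n : ℕ) (hc : ∀ i < n, H.Adj (c i) (c (i + 1))) :
    ∃ p : H.Walk (c 0) (c n), p.length = n ∧ ∀ i ≤ n, p.getVert i = c i := by
  induction n generalizing c with
  | zero => exact ⟨Walk.nil, rfl, fun i hi => by obtain rfl : i = 0 := by omega
                                                 rfl⟩
  | succ n ih =>
    obtain ⟨p, hp, hpc⟩ := ih (fun i => c (i + 1)) fun i hi => hc (i + 1) (by omega)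
    refine ⟨Walk.cons (hc 0 (by omega)) p, by simp [hp], fun i hi => ?_⟩
    cases i with
    | zero => rfl
    | succ i => rw [getVert_cons_succ, hpc i (by omega)]

theorem exists_isCycle_of_injOn (c : ℕ → α) (n : ℕ) (hn : 3 ≤ n)
    (hc : ∀ i < n, H.Adj (c i) (c (i + 1))) (h0 : c n = c 0)
    (hinj : ∀ i j, i < n → j < n → c i = c j → i = j) :
    ∃ p : H.Walk (c 0) (c 0), p.IsCycle ∧ p.length = n ∧ ∀ i ≤ n, p.getVert i = c i := by
  obtain ⟨p, hp, hpc⟩ := exists_getVert_eq c n hc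
  refine ⟨p.copy rfl h0, ?_, by simpa using hp, by simpa using hpc⟩
  rw [isCycle_iff_isPath_tail_and_le_length]
  refine ⟨?_, by simpa [hp] using hn⟩
  rw [← IsPath.getVert_injOn_iff]
  intro i hi j hj hij
  have hlen : (p.copy rfl h0).tail.length = n - 1 := by simp [hp]
  simp only [hlen, Set.mem_ofPred_eq] at hi hj
  simp only [getVert_tail, getVert_copy] at hij
  rw [hpc _ (by omega), hpc _ (by omega)] at hij
  -- The tail visits the positions `1, …, n`. The last one is moved back to `0`, so that `hinj`
  -- applies.
  have hmod : ∀ a, a + 1 ≤ n → ∃ b < n, c (a + 1) = c b ∧ (b = a + 1 ∨ (b = 0 ∧ a + 1 = n)) := by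
    intro a ha
    by_cases han : a + 1 = n
    · exact ⟨0, by omega, by rw [han, h0], Or.inr ⟨rfl, han⟩⟩
    · exact ⟨a + 1, by omega, rfl, Or.inl rfl⟩
  obtain ⟨i', hi', hci, hi''⟩ := hmod i (by omega)
  obtain ⟨j', hj', hcj, hj''⟩ := hmod j (by omega)
  have := hinj i' j' hi' hj' (by rw [← hci, ← hcj, hij])
  omega

end Walk

namespace RotationSystem

variable {V : Type*} {G : SimpleGraph V} (ρ : G.RotationSystem)

/-- `c 0, …, c (n - 1)` is a cyclic enumeration of the faces that are different from the faces `v`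
and `w` and adjacent to one of them, and the edges that leave the boundary of `v` and `w` are
exactly those that separate consecutive faces of this enumeration. -/
structure IsRing (v w : ρ.untwisted.Face) (n : ℕ) (c : ℕ → ρ.untwisted.Face) : Prop where
  closed : c n = c 0
  inj : ∀ i j, i < n → j < n → c i = c j → i = j
  ringFace_iff : ∀ f, ρ.RingFace v w f ↔ ∃ i < n, c i = f
  exists_dart : ∀ i < n, ∃ t : G.Dart, ρ.dartFace t = c (i + 1) ∧ ρ.dartFace t.symm = c i ∧
    ρ.NearVertex v w t.fst
  eq_of_dart : ∀ t : G.Dart, ρ.NearVertex v w t.fst → ¬ ρ.NearVertex v w t.snd →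
    ∃ i < n, ρ.dartFace t = c (i + 1) ∧ ρ.dartFace t.symm = c i

variable {ρ}

/-- The dart `t` leaves the face of `d` between two consecutive edges and separates the faces across
them. It does not start at an end of `d`, because there it would border the face of `d.symm`. -/
theorem IsCubicFive.exists_nbrFace_of_faceAt [Finite V] [G.LocallyFinite] (h : ρ.IsCubicFive)
    {d t : G.Dart} (hd : ρ.FaceAt t.fst (ρ.dartFace d)) (hn : ¬ ρ.FaceAt t.snd (ρ.dartFace d))
    (hn' : ¬ ρ.FaceAt t.snd (ρ.dartFace d.symm)) :
    ∃ i, 0 < i ∧ i + 1 < (ρ.dartFace d).length ∧ ρ.dartFace t = ρ.nbrFace d (i + 1) ∧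
      ρ.dartFace t.symm = ρ.nbrFace d i := by
  cases nonempty_fintype V
  classical
  obtain ⟨a, ha, ha'⟩ := hd
  have hta : t = ρ.next a := by
    rcases h.eq_cases_of_fst_eq (d := a) (d' := t) ha.symm with rfl | rfl | rfl
    · exact (hn (ha' ▸ faceAt_snd t)).elim
    · rfl
    · refine (hn ?_).elim
      have := faceAt_symm_of_mem_edge (ρ := ρ) (Sym2.mem_mk_right (ρ.next (ρ.next a)).fst
        (ρ.next (ρ.next a)).snd)
      rwa [← dartFace_next, h.next_next_next, ha'] at this
  obtain ⟨i, hi, rfl⟩ := exists_faceNext_pow_eq ha'.symm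
  have ht : ρ.dartFace t = ρ.nbrFace d i := by rw [hta, dartFace_next]; rfl
  have hts : ∀ j, i = j + 1 → ρ.dartFace t.symm = ρ.nbrFace d j := by
    rintro j rfl
    rw [hta, faceNext_pow_succ, h.dartFace_next_faceNext_symm]; rfl
  have hi0 : i ≠ 0 := by
    rintro rfl
    exact hn' (by rw [← nbrFace_zero, ← ht]; exact faceAt_snd t)
  have hi1 : i ≠ 1 := by
    rintro rfl
    refine hn' ?_
    rw [← nbrFace_zero, ← hts 0 rfl]
    exact faceAt_symm_of_mem_edge (Sym2.mem_mk_right _ _)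
  refine ⟨i - 1, by omega, by omega, ?_, hts _ (by omega)⟩
  rw [ht, Nat.sub_add_cancel (by omega)]

theorem exists_dart_nbrFace [Finite V] [G.LocallyFinite] (h : ρ.IsCubicFive) (d : G.Dart) (i : ℕ) :
    ∃ t : G.Dart, ρ.dartFace t = ρ.nbrFace d (i + 1) ∧ ρ.dartFace t.symm = ρ.nbrFace d i ∧
      ρ.FaceAt t.fst (ρ.dartFace d) := by
  refine ⟨ρ.next ((ρ.faceNext ^ (i + 1)) d), dartFace_next _ _, ?_, ?_⟩
  · rw [faceNext_pow_succ, h.dartFace_next_faceNext_symm]; rfl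
  · exact ⟨(ρ.faceNext ^ (i + 1)) d, by rw [ρ.fst_next], by simp⟩

theorem IsCubicFive.exists_isRing [Finite V] [G.LocallyFinite] (h : ρ.IsCubicFive)
    {v w : ρ.untwisted.Face} (hvw : ρ.untwisted.dualGraph.Adj v w) {p q : ℕ}
    (hv : v.length = p + 2) (hw : w.length = q + 2) (hp : 2 ≤ p) (hq : 2 ≤ q) :
    ∃ c, ρ.IsRing v w (p + q) c := by
  cases nonempty_fintype V
  classical
  obtain ⟨hne, d, rfl, rfl⟩ := ρ.dualGraph_adj.1 hvw
  have hdd : ρ.nbrFace d.symm 0 = ρ.dartFace d := by simp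
  -- At either end of `d` the third face is the last neighbour of one of the two faces and the first
  -- neighbour of the other.
  have junction : ρ.nbrFace d (p + 1) = ρ.nbrFace d.symm 1 :=
    h.nbrFace_of_succ_eq_length hv.symm
  have junction' : ρ.nbrFace d.symm (q + 1) = ρ.nbrFace d 1 := by
    simpa using h.nbrFace_of_succ_eq_length (d := d.symm) hw.symm
  -- Positions `0, …, p` are the neighbours `1, …, p + 1` of `v`. Position `p` is also neighbour `1`
  -- of `w`, which explains the index `n - p + 1` afterwards.
  obtain ⟨c, hc⟩ : ∃ c : ℕ → ρ.untwisted.Face, c = fun n =>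
    if n ≤ p then ρ.nbrFace d (n + 1) else ρ.nbrFace d.symm (n - p + 1) := ⟨_, rfl⟩
  have hcl : ∀ n ≤ p, c n = ρ.nbrFace d (n + 1) := fun n hn => by rw [hc]; exact if_pos hn
  have hcr : ∀ n, c (p + n) = ρ.nbrFace d.symm (n + 1) := by
    intro n
    rcases Nat.eq_zero_or_pos n with rfl | hn
    · rw [hcl _ (by omega), Nat.add_zero, junction]
    · rw [hc]
      simp only [if_neg (show ¬ p + n ≤ p by omega), Nat.add_sub_cancel_left]
  have mixed : ∀ i < p + q, ∀ j < p + q, i ≤ p → p < j → c i = c j → i = j := by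
    intro i hi j hj hip hpj hij
    obtain ⟨j, rfl⟩ := Nat.exists_eq_add_of_lt hpj
    rw [hcl i hip, Nat.add_assoc, hcr] at hij
    rcases h.nbrFace_eq_nbrFace_symm (by omega) (by omega) (by omega) (by omega) hij with e | e <;>
      omega
  refine ⟨c, ?_, ?_, ?_, ?_, ?_⟩
  · rw [hcr, junction', hcl 0 (by omega)]
  · intro i j hi hj hij
    rcases le_or_gt i p with hip | hip <;> rcases le_or_gt j p with hjp | hjp
    · rw [hcl i hip, hcl j hjp] at hij
      have := h.nbrFace_injOn d (by omega) (by omega) hij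
      omega
    · exact mixed i hi j hj hip hjp hij
    · exact (mixed j hj i hi hjp hip hij.symm).symm
    · obtain ⟨i, rfl⟩ := Nat.exists_eq_add_of_lt hip
      obtain ⟨j, rfl⟩ := Nat.exists_eq_add_of_lt hjp
      rw [Nat.add_assoc, Nat.add_assoc, hcr, hcr] at hij
      have := h.nbrFace_injOn d.symm (by omega) (by omega) hij
      omega
  · intro f
    constructor
    · rintro ⟨hfv, hfw, hf | hf⟩
      · obtain ⟨-, i, hi, rfl⟩ := adj_dartFace_iff.1 hf
        have : i ≠ 0 := by rintro rfl; exact hfw rfl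
        exact ⟨i - 1, by omega, by rw [hcl _ (by omega), Nat.sub_add_cancel (by omega)]⟩
      · obtain ⟨-, i, hi, rfl⟩ := adj_dartFace_iff.1 hf
        have hi0 : i ≠ 0 := by rintro rfl; exact hfv hdd
        by_cases hiq : i = q + 1
        · exact ⟨0, by omega, by rw [hcl _ (by omega), hiq, junction']⟩
        · exact ⟨p + (i - 1), by omega, by rw [hcr, Nat.sub_add_cancel (by omega)]⟩
    · rintro ⟨i, hi, rfl⟩
      have hl : ∀ j, 0 < j → j < p + 2 → ρ.RingFace (ρ.dartFace d) (ρ.dartFace d.symm)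
          (ρ.nbrFace d j) := by
        intro j hj hjp
        refine ⟨h.nbrFace_ne d j, fun e => ?_, Or.inl (adj_dartFace_iff.2
          ⟨(h.nbrFace_ne d j).symm, j, by omega, rfl⟩)⟩
        have := h.nbrFace_injOn d (j := 0) (by omega) (by omega) e
        omega
      have hr : ∀ j, 0 < j → j < q + 2 → ρ.RingFace (ρ.dartFace d) (ρ.dartFace d.symm)
          (ρ.nbrFace d.symm j) := by
        intro j hj hjp
        refine ⟨fun e => ?_, h.nbrFace_ne d.symm j, Or.inr (adj_dartFace_iff.2
          ⟨(h.nbrFace_ne d.symm j).symm, j, by omega, rfl⟩)⟩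
        have := h.nbrFace_injOn d.symm (j := 0) (by omega) (by omega) (e.trans hdd.symm)
        omega
      rcases le_or_gt i p with hip | hip
      · rw [hcl i hip]; exact hl _ (by omega) (by omega)
      · obtain ⟨i, rfl⟩ := Nat.exists_eq_add_of_lt hip
        rw [Nat.add_assoc, hcr]; exact hr _ (by omega) (by omega)
  · intro i hi
    rcases Nat.lt_or_ge i p with hip | hip
    · obtain ⟨t, ht, ht', htn⟩ := exists_dart_nbrFace h d (i + 1)
      exact ⟨t, by rw [ht, hcl _ (by omega)], by rw [ht', hcl _ (by omega)], Or.inl htn⟩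
    · obtain ⟨i, rfl⟩ := Nat.exists_eq_add_of_le hip
      obtain ⟨t, ht, ht', htn⟩ := exists_dart_nbrFace h d.symm (i + 1)
      exact ⟨t, by rw [ht, Nat.add_assoc p, hcr], by rw [ht', hcr], Or.inr htn⟩
  · intro t ht hts
    rw [NearVertex, not_or] at hts
    rcases ht with ht | ht
    · obtain ⟨i, hi0, hi, e, e'⟩ := h.exists_nbrFace_of_faceAt ht hts.1 hts.2
      obtain ⟨i, rfl⟩ := Nat.exists_eq_add_of_lt hi0
      refine ⟨i, by omega, ?_, ?_⟩
      · rw [e, hcl _ (by omega), Nat.zero_add]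
      · rw [e', hcl _ (by omega), Nat.zero_add]
    · obtain ⟨i, hi0, hi, e, e'⟩ := h.exists_nbrFace_of_faceAt ht hts.2
        (by rw [Dart.symm_symm]; exact hts.1)
      obtain ⟨i, rfl⟩ := Nat.exists_eq_add_of_lt hi0
      refine ⟨p + i, by omega, ?_, ?_⟩
      · rw [e, Nat.zero_add, Nat.add_assoc p, hcr]
      · rw [e', hcr, Nat.zero_add]

end RotationSystem

end SimpleGraph

/-! ### Invariants of the twisted facial walks; strongness and orientability -/

namespace SimpleGraph

namespace RotationSystem

variable {V : Type*} {G : SimpleGraph V}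

open Classical in
/-- The parity of the position of a face in the cyclic enumeration `c 0, …, c (n - 1)`. -/
noncomputable def ringParity {α : Type*} (n : ℕ) (c : ℕ → α) (f : α) : ZMod 2 :=
  if ∃ i < n, c i = f ∧ Even i then 0 else 1

theorem ringParity_apply {α : Type*} {n : ℕ} {c : ℕ → α} (hpos : 0 < n) (hn : Even n)
    (h0 : c n = c 0)
    (hinj : ∀ i j, i < n → j < n → c i = c j → i = j) {i : ℕ} (hi : i ≤ n) :
    ringParity n c (c i) = i := by
  have key : ∀ i < n, ringParity n c (c i) = i := by
    intro i hi
    unfold ringParity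
    by_cases he : Even i
    · rw [if_pos ⟨i, hi, rfl, he⟩, (ZMod.natCast_eq_zero_iff_even).2 he]
    · rw [if_neg, (ZMod.natCast_eq_one_iff_odd).2 (Nat.not_even_iff_odd.1 he)]
      rintro ⟨j, hj, hij, hje⟩
      exact he (hinj j i hj hi hij ▸ hje)
  rcases hi.lt_or_eq with hi | rfl
  · exact key i hi
  · rw [h0, key 0 hpos, (ZMod.natCast_eq_zero_iff_even).2 hn, Nat.cast_zero]

variable (ρ : G.RotationSystem)

open Classical in
/-- The edges of signature `-1` are those that leave the boundary of the faces `v` and `w`, whose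
neighbours `c 0, …, c (n - 1)` form a ring of even length. -/
structure IsRingTwist [G.LocallyFinite] (v w : ρ.untwisted.Face) (n : ℕ)
    (c : ℕ → ρ.untwisted.Face) (sign : Sym2 V → ℤˣ) : Prop where
  cubicFive : ρ.IsCubicFive
  ring : ρ.IsRing v w n c
  even : Even n
  two_le : 2 ≤ n
  chordless : ∀ t : G.Dart, ρ.RingFace v w (ρ.dartFace t) → ρ.RingFace v w (ρ.dartFace t.symm) →
    ¬ (ρ.NearVertex v w t.fst ↔ ρ.NearVertex v w t.snd)
  sign_eq : ∀ t : G.Dart, sign t.edge =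
    if (ρ.NearVertex v w t.fst ↔ ρ.NearVertex v w t.snd) then 1 else -1

open Classical in
/-- The faces of the twisted embedding are labelled by the old faces outside the ring and by the two
parities. The label of the face that is next to the vertex `x` and starts in the old face `f`. -/
noncomputable def ringLabel (v w : ρ.untwisted.Face) (n : ℕ) (c : ℕ → ρ.untwisted.Face)
    (f : ρ.untwisted.Face) (x : V) : {f // ¬ ρ.RingFace v w f} ⊕ ZMod 2 :=
  if hf : ρ.RingFace v w f then
    Sum.inr (ringParity n c f + if ρ.NearVertex v w x then 1 else 0)
  else Sum.inl ⟨f, hf⟩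

variable {ρ}

theorem ringLabel_of_ringFace {v w f : ρ.untwisted.Face} {n : ℕ} {c : ℕ → ρ.untwisted.Face}
    (hf : ρ.RingFace v w f) (x : V) [Decidable (ρ.NearVertex v w x)] :
    ρ.ringLabel v w n c f x =
      Sum.inr (ringParity n c f + if ρ.NearVertex v w x then 1 else 0) := by
  rw [ringLabel, dif_pos hf]
  congr!

theorem ringLabel_of_not_ringFace {v w f : ρ.untwisted.Face} {n : ℕ} {c : ℕ → ρ.untwisted.Face}
    (hf : ¬ ρ.RingFace v w f) (x : V) : ρ.ringLabel v w n c f x = Sum.inl ⟨f, hf⟩ := dif_neg hf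

theorem step_eq_untwisted (sign : Sym2 V → ℤˣ) (x : G.Dart × ℤˣ) :
    SurfaceEmbedding.step ⟨ρ, sign⟩ x = ρ.untwisted.step (x.1, x.2 * sign x.1.edge) := by
  simp [SurfaceEmbedding.step, untwisted]

theorem rev_eq_untwisted (sign : Sym2 V → ℤˣ) (x : G.Dart × ℤˣ) :
    SurfaceEmbedding.rev ⟨ρ, sign⟩ x = ρ.untwisted.rev (x.1, x.2 * sign x.1.edge) := by
  simp [SurfaceEmbedding.rev, untwisted]

theorem fst_step (E : G.SurfaceEmbedding) (x : G.Dart × ℤˣ) : (E.step x).1.fst = x.1.snd := by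
  obtain ⟨d, s⟩ := x
  have hinv : ∀ e : G.Dart, (E.rot.next.symm e).fst = e.fst := fun e => by
    rw [← E.rot.fst_next (E.rot.next.symm e)]; simp
  rcases Int.units_eq_one_or (s * E.sign d.edge) with hs | hs
  · simp [SurfaceEmbedding.step, hs, E.rot.fst_next]
  · simp [SurfaceEmbedding.step, hs, hinv]

namespace IsRingTwist

variable [G.LocallyFinite] {v w : ρ.untwisted.Face} {n : ℕ} {c : ℕ → ρ.untwisted.Face}
  {sign : Sym2 V → ℤˣ} (h : ρ.IsRingTwist v w n c sign)

include h

theorem ringParity_apply {i : ℕ} (hi : i ≤ n) : ringParity n c (c i) = i :=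
  RotationSystem.ringParity_apply (two_pos.trans_le h.two_le) h.even h.ring.closed h.ring.inj hi

theorem ringFace {i : ℕ} (hi : i ≤ n) : ρ.RingFace v w (c i) := by
  have := h.two_le
  rcases hi.lt_or_eq with hi | rfl
  · exact (h.ring.ringFace_iff _).2 ⟨i, hi, rfl⟩
  · exact (h.ring.ringFace_iff _).2 ⟨0, by omega, h.ring.closed.symm⟩

/-- A twisted edge separates consecutive ring positions. Their parities differ also where the
enumeration closes up, because `n` is even. -/
theorem ringFace_of_not_iff {t : G.Dart}
    (ht : ¬ (ρ.NearVertex v w t.fst ↔ ρ.NearVertex v w t.snd)) :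
    ρ.RingFace v w (ρ.dartFace t) ∧ ρ.RingFace v w (ρ.dartFace t.symm) ∧
      ringParity n c (ρ.dartFace t.symm) = ringParity n c (ρ.dartFace t) + 1 := by
  have key : ∀ t : G.Dart, ρ.NearVertex v w t.fst → ¬ ρ.NearVertex v w t.snd →
      ρ.RingFace v w (ρ.dartFace t) ∧ ρ.RingFace v w (ρ.dartFace t.symm) ∧
      ringParity n c (ρ.dartFace t.symm) = ringParity n c (ρ.dartFace t) + 1 := by
    intro t ht ht'
    obtain ⟨i, hi, e, e'⟩ := h.ring.eq_of_dart t ht ht'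
    rw [e, e', h.ringParity_apply hi.le, h.ringParity_apply (i := i + 1) hi]
    refine ⟨h.ringFace hi, h.ringFace hi.le, ?_⟩
    rw [Nat.cast_succ, add_assoc, CharTwo.add_self_eq_zero, add_zero]
  by_cases h1 : ρ.NearVertex v w t.fst
  · exact key t h1 (by tauto)
  · have h2 : ρ.NearVertex v w t.snd := by
      by_contra h2
      exact ht (iff_of_false h1 h2)
    obtain ⟨a, b, e⟩ := key t.symm h2 h1
    rw [Dart.symm_symm] at b e
    refine ⟨b, a, ?_⟩
    rw [e, add_assoc, CharTwo.add_self_eq_zero, add_zero]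

/-- A twisted edge changes both the parity of the old face and nearness, and the two changes cancel.
An untwisted edge changes neither. -/
theorem ringLabel_mul_sign (d : G.Dart) (s : ℤˣ) :
    ρ.ringLabel v w n c (ρ.untwisted.faceOf (d, s * sign d.edge)) d.snd =
      ρ.ringLabel v w n c (ρ.untwisted.faceOf (d, s)) d.fst := by
  classical
  rw [h.sign_eq]
  split_ifs with hd
  · rw [mul_one]
    by_cases hf : ρ.RingFace v w (ρ.untwisted.faceOf (d, s))
    · rw [ringLabel_of_ringFace hf, ringLabel_of_ringFace hf]
      simp only [hd]
    · rw [ringLabel_of_not_ringFace hf, ringLabel_of_not_ringFace hf]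
  · obtain ⟨r, r', e⟩ := h.ringFace_of_not_iff hd
    have hone : (1 : ZMod 2) + 1 = 0 := CharTwo.add_self_eq_zero 1
    rcases Int.units_eq_one_or s with rfl | rfl
    · rw [one_mul, faceOf_untwisted_neg_one, faceOf_untwisted_one, ringLabel_of_ringFace r,
        ringLabel_of_ringFace r', e]
      split_ifs <;> first | tauto | simp [add_assoc, hone]
    · rw [neg_mul_neg, one_mul, faceOf_untwisted_neg_one, faceOf_untwisted_one,
        ringLabel_of_ringFace r, ringLabel_of_ringFace r', e]
      split_ifs <;> first | tauto | simp [add_assoc, hone]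

theorem ringLabel_step (x : G.Dart × ℤˣ) :
    ρ.ringLabel v w n c (ρ.untwisted.faceOf (SurfaceEmbedding.step ⟨ρ, sign⟩ x))
        (SurfaceEmbedding.step ⟨ρ, sign⟩ x).1.fst =
      ρ.ringLabel v w n c (ρ.untwisted.faceOf x) x.1.fst := by
  rw [fst_step, ← h.ringLabel_mul_sign x.1 x.2, step_eq_untwisted]
  congr 1
  exact Eq.symm (Quot.sound (Or.inl rfl))

theorem ringLabel_rev (x : G.Dart × ℤˣ) :
    ρ.ringLabel v w n c (ρ.untwisted.faceOf (SurfaceEmbedding.rev ⟨ρ, sign⟩ x))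
        (SurfaceEmbedding.rev ⟨ρ, sign⟩ x).1.fst =
      ρ.ringLabel v w n c (ρ.untwisted.faceOf x) x.1.fst := by
  rw [← h.ringLabel_mul_sign x.1 x.2, rev_eq_untwisted]
  change ρ.ringLabel v w n c _ x.1.snd = _
  congr 1
  exact Eq.symm (Quot.sound (Or.inr rfl))

-- This is the orientation after reversing the rotation at the near vertices, where nothing is
-- twisted any more.
open Classical in
theorem orientation_step (x : G.Dart × ℤˣ) :
    (SurfaceEmbedding.step ⟨ρ, sign⟩ x).2 *
        (if ρ.NearVertex v w (SurfaceEmbedding.step ⟨ρ, sign⟩ x).1.fst then -1 else 1) =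
      x.2 * (if ρ.NearVertex v w x.1.fst then -1 else 1) := by
  rw [fst_step]
  change x.2 * sign x.1.edge * _ = _
  rw [h.sign_eq]
  split_ifs <;> first | tauto | simp

/-- The signature is the coboundary of the nearness sign, so its product along a walk depends on the
ends only. -/
theorem isOrientable : SurfaceEmbedding.IsOrientable ⟨ρ, sign⟩ := by
  classical
  have key : ∀ (x y : V) (p : G.Walk x y), (p.edges.map sign).prod =
      (if ρ.NearVertex v w x then -1 else 1) * (if ρ.NearVertex v w y then -1 else 1) := by
    intro x y p
    induction p with
    | nil =>
      simp only [Walk.edges_nil, List.map_nil, List.prod_nil]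
      split_ifs <;> simp
    | @cons x y z hadj p ih =>
      rw [Walk.edges_cons, List.map_cons, List.prod_cons, ih]
      have := h.sign_eq ⟨(x, y), hadj⟩
      rw [Dart.edge_mk] at this
      rw [this]
      dsimp only
      split_ifs <;> tauto
  intro x p _
  exact (key x x p).trans (by split_ifs <;> simp)

variable [Finite V]

/-- Different old faces at a vertex are separated by an edge. If both are in the ring, that edge is
twisted by `chordless`, so the parities differ while the nearness term is the same. -/
theorem eq_of_ringLabel_eq {d d' : G.Dart} {s : ℤˣ} (hd : d.fst = d'.fst)
    (hl : ρ.ringLabel v w n c (ρ.untwisted.faceOf (d, s)) d.fst =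
      ρ.ringLabel v w n c (ρ.untwisted.faceOf (d', s)) d.fst) : d = d' := by
  classical
  have hat : ∀ e : G.Dart, ρ.FaceAt e.fst (ρ.untwisted.faceOf (e, s)) := by
    intro e
    rcases Int.units_eq_one_or s with rfl | rfl
    · exact faceAt_fst e
    · rw [faceOf_untwisted_neg_one]
      exact faceAt_symm_of_mem_edge (Sym2.mem_mk_left _ _)
  have hfe : ρ.untwisted.faceOf (d, s) = ρ.untwisted.faceOf (d', s) := by
    by_contra hne
    obtain ⟨t, -, ht, ht'⟩ := h.cubicFive.exists_dart_of_faceAt (hat d) (hd ▸ hat d') hne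
    rw [← ht, ← ht'] at hl
    by_cases hf : ρ.RingFace v w (ρ.dartFace t)
    · by_cases hf' : ρ.RingFace v w (ρ.dartFace t.symm)
      · obtain ⟨-, -, e⟩ := h.ringFace_of_not_iff (h.chordless t hf hf')
        rw [ringLabel_of_ringFace hf, ringLabel_of_ringFace hf', e] at hl
        have := Sum.inr_injective hl
        rw [add_right_cancel_iff] at this
        exact one_ne_zero (left_eq_add.1 this)
      · rw [ringLabel_of_ringFace hf, ringLabel_of_not_ringFace hf'] at hl
        cases hl
    · by_cases hf' : ρ.RingFace v w (ρ.dartFace t.symm)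
      · rw [ringLabel_of_not_ringFace hf, ringLabel_of_ringFace hf'] at hl
        cases hl
      · rw [ringLabel_of_not_ringFace hf, ringLabel_of_not_ringFace hf'] at hl
        exact h.cubicFive.dartFace_symm_ne t (congrArg Subtype.val (Sum.inl_injective hl)).symm
  rcases Int.units_eq_one_or s with rfl | rfl
  · exact h.cubicFive.eq_of_dartFace_eq_of_fst_eq hfe hd
  · rw [faceOf_untwisted_neg_one, faceOf_untwisted_neg_one, ← dartFace_next, ← dartFace_next] at hfe
    exact ρ.next.injective (h.cubicFive.eq_of_dartFace_eq_of_fst_eq hfe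
      (by rw [ρ.fst_next, ρ.fst_next, hd]))

theorem isStrong : SurfaceEmbedding.IsStrong ⟨ρ, sign⟩ := by
  classical
  cases nonempty_fintype V
  intro x
  have hinj := SurfaceEmbedding.step_injective ⟨ρ, sign⟩
  set f : G.Dart × ℤˣ → G.Dart × ℤˣ := SurfaceEmbedding.step ⟨ρ, sign⟩ with hf
  have hpos : 0 < Function.minimalPeriod f x :=
    Function.minimalPeriod_pos_of_mem_periodicPts (hinj.mem_periodicPts x)
  refine ⟨?_, ?_⟩
  · by_contra hlt
    have hper := Function.iterate_minimalPeriod (f := f) (x := x)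
    obtain hp | hp : Function.minimalPeriod f x = 1 ∨ Function.minimalPeriod f x = 2 := by omega
    · rw [hp] at hper
      have := fst_step ⟨ρ, sign⟩ x
      rw [← hf, show f x = x from hper] at this
      exact x.1.fst_ne_snd this
    · rw [hp] at hper
      have hper' : f (f x) = x := hper
      have h1 := fst_step ⟨ρ, sign⟩ x
      have h2 := fst_step ⟨ρ, sign⟩ (f x)
      rw [← hf] at h1 h2
      rw [hper'] at h2
      -- As `G` is simple, a walk of length two returns along its first edge, so the rotation would
      -- fix a dart.
      have h3 : (f x).1 = x.1.symm := Dart.ext _ _ (Prod.ext h1 h2.symm)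
      have h4 : ∀ (u : ℤˣ), (ρ.next ^ (u : ℤ)) x.1.symm ≠ x.1.symm := by
        intro u hu
        rcases Int.units_eq_one_or u with rfl | rfl
        · exact h.cubicFive.next_ne _ (by simpa using hu)
        · have hu' : ρ.next⁻¹ x.1.symm = x.1.symm := by simpa using hu
          rw [Equiv.Perm.inv_eq_iff_eq] at hu'
          exact h.cubicFive.next_ne _ hu'.symm
      exact h4 _ h3
  · intro i hi j hj hij
    have hl : ∀ i, ρ.ringLabel v w n c (ρ.untwisted.faceOf (f^[i] x)) (f^[i] x).1.fst =
        ρ.ringLabel v w n c (ρ.untwisted.faceOf x) x.1.fst := by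
      intro i
      induction i with
      | zero => rfl
      | succ i ih => rw [Function.iterate_succ_apply', h.ringLabel_step, ih]
    have ho : ∀ i, (f^[i] x).2 * (if ρ.NearVertex v w (f^[i] x).1.fst then -1 else 1) =
        x.2 * (if ρ.NearVertex v w x.1.fst then -1 else 1) := by
      intro i
      induction i with
      | zero => rfl
      | succ i ih => rw [Function.iterate_succ_apply', h.orientation_step, ih]
    have hs : (f^[i] x).2 = (f^[j] x).2 := by
      have := (ho i).trans (ho j).symm
      rw [hij] at this
      exact mul_right_cancel this
    have hl' := (hl i).trans (hl j).symm
    refine Function.iterate_injOn_Iio_minimalPeriod hi hj (Prod.ext ?_ hs)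
    refine h.eq_of_ringLabel_eq (s := (f^[i] x).2) hij ?_
    rw [← hij] at hl'
    rw [Prod.mk.eta, hl', hs]

end IsRingTwist

end RotationSystem

end SimpleGraph

/-! ### Counting the faces of the twisted embedding -/

namespace SimpleGraph

namespace RotationSystem

variable {V : Type*} {G : SimpleGraph V} {ρ : G.RotationSystem}

namespace IsRing

variable {v w : ρ.untwisted.Face} {n : ℕ} {c : ℕ → ρ.untwisted.Face} (h : ρ.IsRing v w n c)

include h

theorem succ_inj {i j : ℕ} (hi : i < n) (hj : j < n) (hij : c (i + 1) = c (j + 1)) : i = j := by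
  have key : ∀ i j, i < n → j + 1 < n → c (i + 1) = c (j + 1) → i = j := by
    intro i j hi hj hij
    rcases Nat.lt_or_ge (i + 1) n with hi' | hi'
    · have := h.inj _ _ hi' hj hij
      omega
    · rw [show i + 1 = n by omega, h.closed] at hij
      have := h.inj _ _ (by omega) hj hij
      omega
  by_cases hj' : j + 1 < n
  · exact key i j hi hj' hij
  · by_cases hi' : i + 1 < n
    · exact (key j i hj hi' hij.symm).symm
    · omega

theorem card_not_ringFace_add [Finite G.Dart] :
    Nat.card {f // ¬ ρ.RingFace v w f} + n = Nat.card ρ.untwisted.Face := by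
  classical
  have := finite_face ρ.untwisted
  cases nonempty_fintype ρ.untwisted.Face
  have hcard : Nat.card {f // ρ.RingFace v w f} = n := by
    have e : Function.Bijective (fun i : Fin n =>
        (⟨c i, (h.ringFace_iff _).2 ⟨i, i.2, rfl⟩⟩ : {f // ρ.RingFace v w f})) := by
      refine ⟨fun i j hij => Fin.ext (h.inj _ _ i.2 j.2 (congrArg Subtype.val hij)), ?_⟩
      rintro ⟨f, hf⟩
      obtain ⟨i, hi, rfl⟩ := (h.ringFace_iff f).1 hf
      exact ⟨⟨i, hi⟩, rfl⟩
    rw [← Nat.card_congr (Equiv.ofBijective _ e), Nat.card_eq_fintype_card, Fintype.card_fin]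
  rw [← Nat.card_congr (Equiv.sumCompl fun f => ρ.RingFace v w f), Nat.card_sum, hcard, add_comm]

end IsRing

namespace IsRingTwist

variable [G.LocallyFinite] {v w : ρ.untwisted.Face} {n : ℕ} {c : ℕ → ρ.untwisted.Face}
  {sign : Sym2 V → ℤˣ} (h : ρ.IsRingTwist v w n c sign)

include h

theorem faceOf_faceNext {d : G.Dart} (hd : ρ.NearVertex v w d.fst ↔ ρ.NearVertex v w d.snd) :
    SurfaceEmbedding.faceOf ⟨ρ, sign⟩ (ρ.faceNext d, 1) =
      SurfaceEmbedding.faceOf ⟨ρ, sign⟩ (d, 1) := by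
  refine Eq.symm (Quot.sound (Or.inl ?_))
  rw [step_eq_untwisted, h.sign_eq, if_pos hd, mul_one, untwisted_step_one]

theorem faceOf_symm {d : G.Dart} (hd : ¬ (ρ.NearVertex v w d.fst ↔ ρ.NearVertex v w d.snd))
    (s : ℤˣ) :
    SurfaceEmbedding.faceOf ⟨ρ, sign⟩ (d.symm, s) =
      SurfaceEmbedding.faceOf ⟨ρ, sign⟩ (d, s) := by
  refine Eq.symm (Quot.sound (Or.inr ?_))
  rw [rev_eq_untwisted, h.sign_eq, if_neg hd, untwisted_rev, mul_neg_one, neg_neg]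

theorem faceOf_neg_one {d : G.Dart}
    (hd : ¬ (ρ.NearVertex v w d.fst ↔ ρ.NearVertex v w d.snd)) :
    SurfaceEmbedding.faceOf ⟨ρ, sign⟩ (d, -1) =
      SurfaceEmbedding.faceOf ⟨ρ, sign⟩ (ρ.faceNext d, 1) := by
  refine Quot.sound (Or.inl ?_)
  rw [step_eq_untwisted, h.sign_eq, if_neg hd, neg_mul_neg, one_mul, untwisted_step_one]

theorem exists_faceOf_eq (f : SurfaceEmbedding.Face ⟨ρ, sign⟩) :
    ∃ d : G.Dart, SurfaceEmbedding.faceOf ⟨ρ, sign⟩ (d, 1) = f := by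
  obtain ⟨d, s⟩ := f
  rcases Int.units_eq_one_or s with rfl | rfl
  · exact ⟨d, rfl⟩
  · by_cases hd : ρ.NearVertex v w d.fst ↔ ρ.NearVertex v w d.snd
    · refine ⟨d.symm, Eq.symm (Quot.sound (Or.inr ?_))⟩
      rw [rev_eq_untwisted, h.sign_eq, if_pos hd, untwisted_rev, mul_one, neg_neg]
    · exact ⟨ρ.faceNext d, (h.faceOf_neg_one hd).symm⟩

theorem faceOf_faceNext_pow {d : G.Dart} (i : ℕ) (hi : ∀ j < i,
      (ρ.NearVertex v w ((ρ.faceNext ^ j) d).fst ↔ ρ.NearVertex v w ((ρ.faceNext ^ j) d).snd)) :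
    SurfaceEmbedding.faceOf ⟨ρ, sign⟩ ((ρ.faceNext ^ i) d, 1) =
      SurfaceEmbedding.faceOf ⟨ρ, sign⟩ (d, 1) ∧
    (ρ.NearVertex v w ((ρ.faceNext ^ i) d).fst ↔ ρ.NearVertex v w d.fst) := by
  induction i with
  | zero => exact ⟨rfl, Iff.rfl⟩
  | succ i ih =>
    obtain ⟨e, e'⟩ := ih fun j hj => hi j (by omega)
    have := hi i (by omega)
    rw [faceNext_pow_succ, h.faceOf_faceNext this, fst_faceNext, e]
    exact ⟨rfl, this.symm.trans e'⟩

theorem exists_ringDart : ∃ T : ℕ → G.Dart, ∀ i < n, ρ.dartFace (T i) = c (i + 1) ∧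
    ρ.dartFace (T i).symm = c i ∧ ρ.NearVertex v w (T i).fst ∧ ¬ ρ.NearVertex v w (T i).snd := by
  have key : ∀ i : ℕ, ∃ t : G.Dart, i < n → ρ.dartFace t = c (i + 1) ∧
      ρ.dartFace t.symm = c i ∧ ρ.NearVertex v w t.fst ∧ ¬ ρ.NearVertex v w t.snd := by
    intro i
    by_cases hi : i < n
    · obtain ⟨t, ht, ht', htn⟩ := h.ring.exists_dart i hi
      have := h.chordless t (ht ▸ h.ringFace hi) (ht' ▸ h.ringFace hi.le)
      exact ⟨t, fun _ => ⟨ht, ht', htn, fun e => this (iff_of_true htn e)⟩⟩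
    -- Outside the range of the ring any dart serves as a default value.
    · obtain ⟨t, -⟩ := h.ring.exists_dart 0 (by have := h.two_le; omega)
      exact ⟨t, fun hi' => (hi hi').elim⟩
  choose T hT using key
  exact ⟨T, hT⟩

variable [Finite V]

theorem faceOf_eq_of_not_ringFace {d d' : G.Dart} (hd : ¬ ρ.RingFace v w (ρ.dartFace d))
    (hdd' : ρ.dartFace d = ρ.dartFace d') :
    SurfaceEmbedding.faceOf ⟨ρ, sign⟩ (d, 1) = SurfaceEmbedding.faceOf ⟨ρ, sign⟩ (d', 1) := by
  classical
  cases nonempty_fintype V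
  obtain ⟨i, -, rfl⟩ := exists_faceNext_pow_eq hdd'
  refine (h.faceOf_faceNext_pow i fun j _ => ?_).1.symm
  by_contra hcon
  have := (h.ringFace_of_not_iff hcon).1
  rw [dartFace_faceNext_pow] at this
  exact hd this

/-- A facial walk of the twisted embedding that runs along a face of the ring eventually leaves it
through a twisted edge. -/
theorem exists_twisted {d : G.Dart} (hd : ρ.RingFace v w (ρ.dartFace d)) :
    ∃ t : G.Dart, ¬ (ρ.NearVertex v w t.fst ↔ ρ.NearVertex v w t.snd) ∧
      ρ.dartFace t = ρ.dartFace d ∧ (ρ.NearVertex v w t.fst ↔ ρ.NearVertex v w d.fst) ∧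
      SurfaceEmbedding.faceOf ⟨ρ, sign⟩ (t, 1) = SurfaceEmbedding.faceOf ⟨ρ, sign⟩ (d, 1) := by
  classical
  cases nonempty_fintype V
  obtain ⟨k, hk, hkd⟩ := (h.ring.ringFace_iff _).1 hd
  obtain ⟨t, ht, ht', -⟩ := h.ring.exists_dart k hk
  have htw := h.chordless t (ht ▸ h.ringFace hk) (ht' ▸ h.ringFace hk.le)
  obtain ⟨i, -, hi⟩ := exists_faceNext_pow_eq (hkd.symm.trans ht'.symm)
  have hex : ∃ i, ¬ (ρ.NearVertex v w ((ρ.faceNext ^ i) d).fst ↔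
      ρ.NearVertex v w ((ρ.faceNext ^ i) d).snd) :=
    ⟨i, by rw [hi]; exact fun e => htw e.symm⟩
  obtain ⟨e, e'⟩ := h.faceOf_faceNext_pow (Nat.find hex) fun j hj =>
    not_not.1 (Nat.find_min hex hj)
  exact ⟨_, Nat.find_spec hex, by simp, e', e⟩

theorem natCard_face :
    Nat.card (SurfaceEmbedding.Face ⟨ρ, sign⟩) = Nat.card {f // ¬ ρ.RingFace v w f} + 2 := by
  classical
  cases nonempty_fintype V
  have := finite_face ρ.untwisted
  obtain ⟨T, hT⟩ := h.exists_ringDart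
  have hn := h.two_le
  set K : G.Dart → SurfaceEmbedding.Face ⟨ρ, sign⟩ := fun d =>
    SurfaceEmbedding.faceOf ⟨ρ, sign⟩ (d, 1) with hK
  have hTw : ∀ i < n, ¬ (ρ.NearVertex v w (T i).fst ↔ ρ.NearVertex v w (T i).snd) := fun i hi e =>
    (hT i hi).2.2.2 (e.1 (hT i hi).2.2.1)
  -- The new face of `T i` contains the near part of `c (i + 1)` (`inner`) and the far part of `c i`
  -- (`outer`): both parts end at the twisted edge of `T i`.
  have inner : ∀ d : G.Dart, ∀ i < n, ρ.dartFace d = c (i + 1) → ρ.NearVertex v w d.fst →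
      K d = K (T i) := by
    intro d i hi hd hdn
    obtain ⟨t, ht, htd, htn, htK⟩ := h.exists_twisted (hd ▸ h.ringFace hi)
    have htn' := htn.2 hdn
    obtain ⟨j, hj, e, e'⟩ := h.ring.eq_of_dart t htn' fun e => ht (iff_of_true htn' e)
    have hji : j = i := h.ring.succ_inj hj hi (by rw [← e, htd, hd])
    subst hji
    have : t = T j := h.cubicFive.eq_of_dartFace_eq (by rw [e, (hT j hj).1])
      (by rw [e', (hT j hj).2.1])
    rw [← this]
    exact htK.symm
  have outer : ∀ d : G.Dart, ∀ i < n, ρ.dartFace d = c i → ¬ ρ.NearVertex v w d.fst →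
      K d = K (T i) := by
    intro d i hi hd hdn
    obtain ⟨t, ht, htd, htn, htK⟩ := h.exists_twisted (hd ▸ h.ringFace hi.le)
    have htn' : ¬ ρ.NearVertex v w t.fst := fun e => hdn (htn.1 e)
    have hts : ρ.NearVertex v w t.snd := by
      by_contra hts
      exact ht (iff_of_false htn' hts)
    obtain ⟨j, hj, e, e'⟩ := h.ring.eq_of_dart t.symm hts htn'
    rw [Dart.symm_symm] at e'
    have hji : j = i := h.ring.inj _ _ hj hi (by rw [← e', htd, hd])
    subst hji
    have : t.symm = T j := h.cubicFive.eq_of_dartFace_eq (by rw [e, (hT j hj).1])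
      (by rw [Dart.symm_symm, e', (hT j hj).2.1])
    rw [← this]
    exact htK.symm.trans (h.faceOf_symm ht 1).symm
  -- The other side of the twisted edge of `T (i + 1)` joins the far part of `c (i + 2)` to the near
  -- part of `c (i + 1)`.
  have hstep : ∀ i, i + 2 < n → K (T (i + 2)) = K (T i) := by
    intro i hi
    obtain ⟨a, b, e, e'⟩ := hT (i + 1) (by omega)
    have tw := hTw (i + 1) (by omega)
    have tw' : ¬ (ρ.NearVertex v w (T (i + 1)).symm.fst ↔ ρ.NearVertex v w (T (i + 1)).symm.snd) :=
      fun hiff => tw hiff.symm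
    rw [← outer (ρ.faceNext (T (i + 1))) (i + 2) hi (by rw [dartFace_faceNext, a])
        (by rwa [fst_faceNext]),
      ← inner (ρ.faceNext (T (i + 1)).symm) i (by omega) (by rw [dartFace_faceNext, b])
        (by rwa [fst_faceNext])]
    exact (h.faceOf_neg_one tw).symm.trans
      ((h.faceOf_symm tw (-1)).symm.trans (h.faceOf_neg_one tw'))
  have hmod : ∀ i < n, K (T i) = K (T (i % 2)) := by
    intro i
    induction i using Nat.strong_induction_on with
    | _ i ih =>
      intro hi
      rcases Nat.lt_or_ge i 2 with h2 | h2
      · rw [Nat.mod_eq_of_lt h2]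
      · obtain ⟨i, rfl⟩ := Nat.exists_eq_add_of_le' h2
        rw [hstep i hi, ih i (by omega) (by omega), Nat.add_mod_right]
  have hpos : ∀ d : G.Dart, ρ.RingFace v w (ρ.dartFace d) → ∃ i < n, K d = K (T i) ∧
      ringParity n c (ρ.dartFace d) + (if ρ.NearVertex v w d.fst then 1 else 0) = (i : ZMod 2) := by
    intro d hd
    obtain ⟨k, hk, hkd⟩ := (h.ring.ringFace_iff _).1 hd
    by_cases hdn : ρ.NearVertex v w d.fst
    · obtain ⟨i, hi, hik⟩ : ∃ i < n, c (i + 1) = c k := by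
        rcases Nat.eq_zero_or_pos k with rfl | hk0
        · exact ⟨n - 1, by omega, by rw [Nat.sub_add_cancel (by omega), h.ring.closed]⟩
        · exact ⟨k - 1, by omega, by rw [Nat.sub_add_cancel hk0]⟩
      refine ⟨i, hi, inner d i hi (by rw [hik, hkd]) hdn, ?_⟩
      rw [if_pos hdn, ← hkd, ← hik, h.ringParity_apply (i := i + 1) hi, Nat.cast_succ, add_assoc,
        CharTwo.add_self_eq_zero, add_zero]
    · refine ⟨k, hk, outer d k hk hkd.symm hdn, ?_⟩
      rw [if_neg hdn, ← hkd, h.ringParity_apply hk.le, add_zero]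
  let L : SurfaceEmbedding.Face ⟨ρ, sign⟩ → {f // ¬ ρ.RingFace v w f} ⊕ ZMod 2 :=
    Quot.lift (fun x => ρ.ringLabel v w n c (ρ.untwisted.faceOf x) x.1.fst) (by
      rintro x y (rfl | rfl)
      · exact (h.ringLabel_step x).symm
      · exact (h.ringLabel_rev x).symm)
  have hL : ∀ d, L (K d) = ρ.ringLabel v w n c (ρ.dartFace d) d.fst := fun d => rfl
  have hbij : Function.Bijective L := by
    constructor
    · intro f f' hff'
      obtain ⟨d, rfl⟩ := h.exists_faceOf_eq f
      obtain ⟨d', rfl⟩ := h.exists_faceOf_eq f'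
      change L (K d) = L (K d') at hff'
      rw [hL, hL] at hff'
      by_cases hd : ρ.RingFace v w (ρ.dartFace d) <;>
        by_cases hd' : ρ.RingFace v w (ρ.dartFace d')
      · rw [ringLabel_of_ringFace hd, ringLabel_of_ringFace hd'] at hff'
        obtain ⟨i, hi, e, p⟩ := hpos d hd
        obtain ⟨j, hj, e', p'⟩ := hpos d' hd'
        have hij := Sum.inr_injective hff'
        rw [p, p', ZMod.natCast_eq_natCast_iff'] at hij
        exact e.trans ((hmod i hi).trans ((hij ▸ (hmod j hj).symm).trans e'.symm))
      · rw [ringLabel_of_ringFace hd, ringLabel_of_not_ringFace hd'] at hff'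
        cases hff'
      · rw [ringLabel_of_not_ringFace hd, ringLabel_of_ringFace hd'] at hff'
        cases hff'
      · rw [ringLabel_of_not_ringFace hd, ringLabel_of_not_ringFace hd'] at hff'
        exact h.faceOf_eq_of_not_ringFace hd (congrArg Subtype.val (Sum.inl_injective hff'))
    · have hLT : ∀ i < n, L (K (T i)) = Sum.inr (i : ZMod 2) := by
        intro i hi
        obtain ⟨a, -, e, -⟩ := hT i hi
        rw [hL, a, ringLabel_of_ringFace (h.ringFace hi), if_pos e,
          h.ringParity_apply (i := i + 1) hi, Nat.cast_succ, add_assoc, CharTwo.add_self_eq_zero,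
          add_zero]
      rintro (⟨f, hf⟩ | b)
      · obtain ⟨d, rfl⟩ := ρ.dartFace_surjective f
        exact ⟨K d, by rw [hL, ringLabel_of_not_ringFace hf]⟩
      -- Both parities occur among the positions `0` and `1`, which exist since `2 ≤ n`.
      · refine ⟨K (T b.val), ?_⟩
        rw [hLT _ ((ZMod.val_lt b).trans_le hn), ZMod.natCast_zmod_val]
  rw [Nat.card_congr (Equiv.ofBijective L hbij), Nat.card_sum, Nat.card_zmod]

/-- Two faces replace the `n` ring faces, so the Euler characteristic drops from `2` by `n - 2 = 2 *
g`. -/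
theorem onOrientableSurface {g : ℕ} (hg : n = 2 * g + 2) :
    SurfaceEmbedding.OnOrientableSurface ⟨ρ, sign⟩ g := by
  classical
  cases nonempty_fintype V
  refine ⟨h.isOrientable, ?_⟩
  have h0 := h.cubicFive.planar.2
  have h1 := h.natCard_face
  have h2 := h.ring.card_not_ringFace_add
  unfold SurfaceEmbedding.eulerChar at h0 ⊢
  push_cast at h0
  omega

end IsRingTwist

end RotationSystem

end SimpleGraph

/-! ### The theorem -/

open SimpleGraph RotationSystem in
theorem mainTheorem8 {V : Type*} [Fintype V] (G : SimpleGraph V) [G.LocallyFinite]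
    (hconn : G.Connected) (hcubic : G.IsRegularOfDegree 3)
    (hcyc : G.CyclicallyEdgeConnected 5)
    (ρ : G.RotationSystem) (hρ : ρ.IsPlanar)
    (k m : ℕ) (hk : 2 ≤ k) (hm : 2 ≤ m)
    (v w : ρ.untwisted.Face) (hvw : ρ.untwisted.dualGraph.Adj v w)
    (hv : v.length = 2 * k + 1) (hw : w.length = 2 * m + 1) :
    ∃ (f : ρ.untwisted.Face) (C : ρ.untwisted.dualGraph.Walk f f),
      C.IsCycle ∧ C.length = 2 * (k + m - 1) ∧
      (∀ u, u ∈ C.support ↔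
        u ≠ v ∧ u ≠ w ∧
          (ρ.untwisted.dualGraph.Adj v u ∨ ρ.untwisted.dualGraph.Adj w u)) ∧
      (ρ.twist C.toSubgraph).IsStrong ∧
      (ρ.twist C.toSubgraph).OnOrientableSurface (k + m - 2) := by
  classical
  have h : ρ.IsCubicFive := ⟨hconn, hcubic, hcyc, hρ⟩
  -- Apart from each other, `v` and `w` have `p + 1` and `q + 1` neighbours, of which two are
  -- common. So the ring has `p + q = 2 * (k + m - 1)` faces.
  obtain ⟨c, hc⟩ := h.exists_isRing hvw (p := 2 * k - 1) (q := 2 * m - 1) (by omega) (by omega)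
    (by omega) (by omega)
  obtain ⟨n, hn⟩ : ∃ n, n = 2 * k - 1 + (2 * m - 1) := ⟨_, rfl⟩
  rw [← hn] at hc
  have chordless := fun t : G.Dart =>
    h.not_nearVertex_iff (t := t) hvw (by omega) (by omega)
  obtain ⟨C, hC, hlen, hget⟩ := Walk.exists_isCycle_of_injOn (H := ρ.untwisted.dualGraph) c n
    (by omega) (fun i hi => by
      obtain ⟨t, ht, ht', -⟩ := hc.exists_dart i hi
      refine adj_of_faces ?_ (d := t.symm) ht' (by rw [Dart.symm_symm, ht])
      rw [← ht, ← ht']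
      exact h.dartFace_symm_ne t) hc.closed hc.inj
  have hsupp : ∀ u, u ∈ C.support ↔ ρ.RingFace v w u := by
    intro u
    rw [Walk.mem_support_iff_exists_getVert, hc.ringFace_iff]
    constructor
    · rintro ⟨i, rfl, hi⟩
      rw [hget i (by omega)]
      rcases (hlen ▸ hi).lt_or_eq with hi | rfl
      · exact ⟨i, hi, rfl⟩
      · exact ⟨0, by omega, hc.closed.symm⟩
    · rintro ⟨i, hi, rfl⟩
      exact ⟨i, hget i hi.le, by omega⟩
  have htwist : ρ.IsRingTwist v w n c (ρ.twist C.toSubgraph).sign := by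
    refine ⟨h, hc, ⟨k + m - 1, by omega⟩, by omega, chordless, fun t => ?_⟩
    change (if _ then _ else _) = _
    -- An edge whose dual is in `C` has ring faces on both sides and is a cut edge by `chordless`.
    -- Conversely, a cut edge separates consecutive faces of `c`, which are adjacent on `C`.
    have key : (∃ f f', C.toSubgraph.Adj f f' ∧ ρ.untwisted.DualJoins t.edge f f') ↔
        ¬ (ρ.NearVertex v w t.fst ↔ ρ.NearVertex v w t.snd) := by
      have adj : ∀ t : G.Dart, ρ.NearVertex v w t.fst → ¬ ρ.NearVertex v w t.snd →
          ∃ f f', C.toSubgraph.Adj f f' ∧ ρ.untwisted.DualJoins t.edge f f' := by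
        intro t ht ht'
        obtain ⟨i, hi, e, e'⟩ := hc.eq_of_dart t ht ht'
        have := C.toSubgraph_adj_getVert (i := i) (by omega)
        rw [hget i hi.le, hget (i + 1) hi] at this
        exact ⟨_, _, this.symm, ρ.dualJoins_untwisted.2 ⟨t, rfl, e, e'⟩⟩
      constructor
      · rintro ⟨f, f', hff', hd⟩
        obtain ⟨d, hdt, rfl, rfl⟩ := ρ.dualJoins_untwisted.1 hd
        have r := (hsupp _).1 (Walk.mem_support_of_adj_toSubgraph hff')
        have r' := (hsupp _).1 (Walk.mem_support_of_adj_toSubgraph hff'.symm)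
        rcases (dart_edge_eq_iff _ _).1 hdt with rfl | rfl
        · exact chordless d r r'
        · rw [Dart.symm_symm] at r'
          exact chordless t r' r
      · intro ht
        by_cases h1 : ρ.NearVertex v w t.fst
        · exact adj t h1 fun h2 => ht (iff_of_true h1 h2)
        · have h2 : ρ.NearVertex v w t.snd := by
            by_contra h2
            exact ht (iff_of_false h1 h2)
          have := adj t.symm h2 h1
          rwa [Dart.edge_symm] at this
    by_cases ht : ρ.NearVertex v w t.fst ↔ ρ.NearVertex v w t.snd
    · rw [if_pos ht, if_neg fun e => key.1 e ht]
    · rw [if_neg ht, if_pos (key.2 ht)]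
  exact ⟨c 0, C, hC, by omega, hsupp, htwist.isStrong, htwist.onOrientableSurface (by omega)⟩
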